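/- Let $\mathcal W_N=\{0,1,\dots,N-1\}^{\mathbb N}$ be the set of infinite words $w=w_1w_2w_3\dots$ on $N$ symbols with the lexicographic order, and let $\Sigma_N:\mathcal W_N\to\mathcal W_N$, $w_1w_2w_3\dots\mapsto w_2w_3w_4\dots$, be the shift. A permutation $\pi\in S_n$ is realized by $\Sigma_N$ if there is $w\in\mathcal W_N$ such that for all $1\le i,j\le n$ one has $\Sigma_N^{i-1}(w)<\Sigma_N^{j-1}(w)$ if and only if $\pi(i)<\pi(j)$. Let $N(\pi)$ be the smallest $N$ such that $\pi$ is realized by $\Sigma_N$, and let $$S_{n,N}=\{\pi\in S_n: N(\pi)=N\},\quad H'_{n,N}=\{\pi\in S_{n,N}:\pi(n)=n\},\quad a_{n,N}=|S_{n,N}|,\quad h_{n,N}=|H'_{n,N}|.$$ To $\pi\in S_n$ ($n\ge2$) with $b=\pi(n)\ne n$ assign an infinite word $w_A(\pi)$ as follows. Let $A(\pi)$ be the set of $a\in\{1,\dots,n-1\}$ such that, for $i=\pi^{-1}(a)$ and $j=\pi^{-1}(a+1)$, one has $i,j<n$ and $\pi(i+1)>\pi(j+1)$. For $1\le i\le n-1$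 put $$w_i=\varepsilon+|\{a\in A(\pi): a+1\le\pi(i)\}|+\delta_i,$$ where $\varepsilon=1$ if $\pi(n)=1$ and $\pi(n-1)=2$, and $\varepsilon=0$ otherwise; and $\delta_i=1$ if $1<b<n$, $\pi(\pi^{-1}(b-1)+1)>\pi(\pi^{-1}(b+1)+1)$ and $\pi(i)\ge b+1$, and $\delta_i=0$ otherwise. With $k=\pi^{-1}(b+1)$, $u=w_1\dots w_{k-1}$ and $p=w_k\dots w_{n-1}$, let $w_A(\pi)=u\,p^{\,n-1}\,0^\infty$. Let $$\Gamma_{n,N}=\{w_A(\pi):\pi\in S_{n,N}\setminus H'_{n,N}\},\qquad g_{n,N}=|\Gamma_{n,N}|.$$ Finally, let $\psi_N(t)$ be the number of primitive words of length $t$ over an $N$-letter alphabet, that is, of words that are not of the form $v^m$ with $m>1$. Then for all integers $n,N\ge 2$, $$g_{n,N}=a_{n,N}-h_{n,N}$$ and $$g_{n,N}=\sum_{i=0}^{N-2}(-1)^i\binom{n}{i}\left(\sum_{t=1}^{n-1}\psi_{N-i}(t)\,(N-i)^{n-t-1}-(N-i)^{n-2}\right).$$ -/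

import Mathlib

namespace ShiftPatterns

/-- `IsPat f x π` says that `Pat(x, f, n)` is defined and equal to `π`: the points
`x, f x, …, f^(n-1) x` are in the same relative order as the entries of `π`.
(As `π` is injective and the order is total, those points are then pairwise distinct.) -/
def IsPat {X : Type*} [LinearOrder X] {n : ℕ} (f : X → X) (x : X)
    (π : Equiv.Perm (Fin n)) : Prop :=
  ∀ i j : Fin n, f^[(i : ℕ)] x < f^[(j : ℕ)] x ↔ π i < π j

/-- The permutations of length `n` realized by `f` (its allowed patterns of length `n`). -/
def allowed {X : Type*} [LinearOrder X] (f : X → X) (n : ℕ) : Set (Equiv.Perm (Fin n)) :=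
  {π | ∃ x : X, IsPat f x π}

/-- Infinite words on the `N` symbols `0, …, N - 1`, in lexicographic order. -/
abbrev Word (N : ℕ) : Type := Lex (ℕ → Fin N)

/-- The one-sided shift `w₁w₂w₃… ↦ w₂w₃w₄…` on `N` symbols. -/
def shift (N : ℕ) (w : Word N) : Word N := toLex fun i => ofLex w (i + 1)

/-- `N(π)`: the smallest `N` such that `π` is realized by the shift on `N` symbols. -/
noncomputable def numSymbols {n : ℕ} (π : Equiv.Perm (Fin n)) : ℕ :=
  sInf {N : ℕ | π ∈ allowed (shift N) n}

/-- One-line notation with the usual numbering from one: for `1 ≤ i ≤ n`, `entry π i` is the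
entry `π(i)`, with value in `{1, …, n}`; it is `0` for all other `i`. -/
def entry {n : ℕ} (π : Equiv.Perm (Fin n)) (i : ℕ) : ℕ :=
  if h : 1 ≤ i ∧ i ≤ n then (π ⟨i - 1, by omega⟩ : ℕ) + 1 else 0

/-- `S_{n,N}`: the permutations of length `n` with `N(π) = N`. -/
def permsNeeding (n N : ℕ) : Set (Equiv.Perm (Fin n)) := {π | numSymbols π = N}

/-- `H'_{n,N}`: those elements of `S_{n,N}` for which `π(n) = n`. -/
def permsFixingLast (n N : ℕ) : Set (Equiv.Perm (Fin n)) :=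
  {π | π ∈ permsNeeding n N ∧ entry π n = n}

/-- `a_{n,N} = |S_{n,N}|`. -/
noncomputable def aNum (n N : ℕ) : ℕ := (permsNeeding n N).ncard

/-- `h_{n,N} = |H'_{n,N}|`. -/
noncomputable def hNum (n N : ℕ) : ℕ := (permsFixingLast n N).ncard

/-- `A(π)`: the `a` with `1 ≤ a ≤ n - 1` such that `a = π(i)`, `a + 1 = π(j)` with `i, j < n` and
`π(i + 1) > π(j + 1)`. -/
def descSet {n : ℕ} (π : Equiv.Perm (Fin n)) : Finset ℕ :=
  {a ∈ Finset.Icc 1 (n - 1) | ∃ i ∈ Finset.Icc 1 (n - 1), ∃ j ∈ Finset.Icc 1 (n - 1),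
    entry π i = a ∧ entry π j = a + 1 ∧ entry π (j + 1) < entry π (i + 1)}

/-- `π(n) ∉ {1, n}`, and `π(i + 1) > π(j + 1)` where `π(i) = π(n) - 1` and `π(j) = π(n) + 1`. -/
def MiddleCase {n : ℕ} (π : Equiv.Perm (Fin n)) : Prop :=
  entry π n ≠ 1 ∧ entry π n ≠ n ∧
    ∃ i ∈ Finset.Icc 1 (n - 1), ∃ j ∈ Finset.Icc 1 (n - 1),
      entry π i + 1 = entry π n ∧ entry π j = entry π n + 1 ∧
        entry π (j + 1) < entry π (i + 1)

/-- `π(n) = 1` and `π(n - 1) = 2`. -/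
def BottomCase {n : ℕ} (π : Equiv.Perm (Fin n)) : Prop :=
  entry π n = 1 ∧ entry π (n - 1) = 2

open Classical in
/-- The letter `w_i`, for `1 ≤ i ≤ n - 1`, of the word assigned to `π`. List the indices
`i ≠ n` by increasing `π(i)`. The first letter in this list is `0` (it is `1` if `π(n) = 1` and
`π(n - 1) = 2`), and the letter goes up by one from the index of value `a` to that of value `a + 1`
for each `a ∈ A(π)`, and from the index of value `π(n) - 1` to that of value `π(n) + 1`
in the situation of `MiddleCase`. -/
noncomputable def letter {n : ℕ} (π : Equiv.Perm (Fin n)) (i : ℕ) : ℕ :=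
  (if BottomCase π then 1 else 0) + {a ∈ descSet π | a + 1 ≤ entry π i}.card
    + (if MiddleCase π ∧ entry π n + 1 ≤ entry π i then 1 else 0)

/-- The finite word `w₁ w₂ … w_{n-1}`. -/
noncomputable def firstLetters {n : ℕ} (π : Equiv.Perm (Fin n)) : List ℕ :=
  List.ofFn fun i : Fin (n - 1) => letter π ((i : ℕ) + 1)

/-- The `m`-th power `p ^ m` of a finite word under concatenation. -/
def wordPow {α : Type*} (p : List α) (m : ℕ) : List α := (List.replicate m p).flatten

/-- The number `k - 1`, where `k` is the index with `π(k) = π(n) + 1`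
(meaningful when `π(n) ≠ n`). -/
noncomputable def splitLength {n : ℕ} (π : Equiv.Perm (Fin n)) : ℕ :=
  sInf {k : ℕ | entry π (k + 1) = entry π n + 1}

/-- The infinite word `w_A(π) = u p^(n-1) 0^∞`, where `u = w₁ … w_{k-1}`, `p = w_k … w_{n-1}` and
`π(k) = π(n) + 1` (meaningful when `π(n) ≠ n`). -/
noncomputable def wA {n : ℕ} (π : Equiv.Perm (Fin n)) : ℕ → ℕ := fun m =>
  ((firstLetters π).take (splitLength π) ++
    wordPow ((firstLetters π).drop (splitLength π)) (n - 1)).getD m 0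

/-- `Γ_{n,N} = {w_A(π) : π ∈ S_{n,N} \ H'_{n,N}}`. -/
def gammaSet (n N : ℕ) : Set (ℕ → ℕ) :=
  wA '' (permsNeeding n N \ permsFixingLast n N)

/-- `g_{n,N} = |Γ_{n,N}|`. -/
noncomputable def gNum (n N : ℕ) : ℕ := (gammaSet n N).ncard

/-- A finite word is primitive if it is not of the form `u ^ m` with `m > 1`. -/
def IsPrimitiveWord {α : Type*} (w : List α) : Prop :=
  ∀ (u : List α) (m : ℕ), 1 < m → w ≠ wordPow u m

/-- `ψ_N(k)`: the number of primitive words of length `k` over an `N`-letter alphabet. -/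
noncomputable def primCount (N k : ℕ) : ℕ :=
  {p : Fin k → Fin N | IsPrimitiveWord (List.ofFn p)}.ncard

end ShiftPatterns

/-! Put m = n - 1. A word realizing π constrains its first m letters (`Compat`): they increase
weakly along π, equal letters pass the order on to the next positions, and in one degenerate case a
letter cannot be 0. If π(n) ≠ n, these conditions suffice. With π(k) = π(n) + 1, close the letters
up into u p^m 0^∞: its tail at n is then the immediate lower neighbour of the tail at k, and the
word realizes π (`Compat.realizes`). The compatible sequences are exactly `letterAt π` plus a
nonnegative sequence that increases weakly along π (`compat_iff`). Hence N(π) is one more than the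
top letter, and w_A(π) realizes π, so w_A is injective; this gives the first formula.

For the second, count in two ways the pairs (π, c) with π(n) ≠ n and c compatible over N letters. A
fixed π contributes binom(m + N - N(π), m) if N(π) ≤ N, and 0 otherwise (`card_compatWords`).
Cutting c at k gives a pair (u, p) with p primitive and nonzero, and each such pair arises exactly
once (`sum_card_compatWords`); these pairs number Σ_t ψ_N(t) N^(m-t) - N^(m-1), the last term
removing p = 0. On generating functions in N the binomials act as the factor (1 - X)^(-(m+1)), and
multiplying by (1 - X)^(m+1) gives the alternating sum. -/

namespace ShiftPatterns

/-! ### Lexicographic order and eventually periodic words. -/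

/-- The lexicographic order on infinite words of natural numbers. -/
def LexLt (x y : ℕ → ℕ) : Prop := ∃ t, (∀ s < t, x s = y s) ∧ x t < y t

/-- The word `x` with its first `i` letters removed. -/
def tailAt (x : ℕ → ℕ) (i : ℕ) : ℕ → ℕ := fun s => x (i + s)

theorem LexLt.asymm {x y : ℕ → ℕ} (h : LexLt x y) : ¬ LexLt y x := by
  rintro ⟨t', h1', h2'⟩
  obtain ⟨t, h1, h2⟩ := h
  rcases lt_trichotomy t t' with h | h | h
  · have := h1' t h; omega
  · subst h; omega
  · have := h1 t' h; omega

theorem LexLt.irrefl (x : ℕ → ℕ) : ¬ LexLt x x := fun ⟨_, _, h⟩ => lt_irrefl _ h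

theorem lexLt_of_first_ne {x y : ℕ → ℕ} (hne : ∃ t, x t ≠ y t)
    (h : ∀ t, (∀ s < t, x s = y s) → x t ≤ y t) : LexLt x y := by
  classical
  refine ⟨Nat.find hne, fun s hs => not_not.1 (Nat.find_min hne hs), ?_⟩
  exact lt_of_le_of_ne (h _ fun s hs => not_not.1 (Nat.find_min hne hs)) (Nat.find_spec hne)

/-- The position, below `k + d`, of the letter number `s` of the eventually periodic word with
preperiod `k` and period `d`. -/
def cyc (k d s : ℕ) : ℕ := if s < k then s else k + (s - k) % d

/-- With `u = c 0 … c (k - 1)` and `p = c k … c (k + d - 1)`, the infinite word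
`u p ^ (k + d) 0 ^ ∞`. -/
def cycWord (c : ℕ → ℕ) (k d s : ℕ) : ℕ := if s < k + (k + d) * d then c (cyc k d s) else 0

theorem succ_mod_eq {d : ℕ} (hd : 0 < d) (x : ℕ) :
    (x + 1) % d = if x % d + 1 < d then x % d + 1 else 0 := by
  have h1 := Nat.div_add_mod x d
  have h2 := Nat.mod_lt x hd
  split_ifs with h
  · rw [show x + 1 = (x % d + 1) + d * (x / d) by omega, Nat.add_mul_mod_self_left,
      Nat.mod_eq_of_lt h]
  · rw [show x + 1 = d * (x / d + 1) by rw [mul_add]; omega, Nat.mul_mod_right]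

section cyc

variable {k d : ℕ}

theorem cyc_lt (hd : 0 < d) (s : ℕ) : cyc k d s < k + d := by
  unfold cyc
  have := Nat.mod_lt (s - k) hd
  split_ifs <;> omega

theorem le_cyc {s : ℕ} (hs : k ≤ s) : k ≤ cyc k d s := by
  unfold cyc; split_ifs <;> omega

theorem cyc_of_lt {s : ℕ} (hs : s < k + d) : cyc k d s = s := by
  unfold cyc
  split_ifs with h
  · rfl
  · rw [Nat.mod_eq_of_lt (by omega)]; omega

theorem cyc_add_period {s : ℕ} (hs : k ≤ s) : cyc k d (s + d) = cyc k d s := by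
  unfold cyc
  rw [if_neg (by omega), if_neg (by omega), show s + d - k = s - k + d by omega,
    Nat.add_mod_right]

theorem cyc_succ (hd : 0 < d) (s : ℕ) :
    cyc k d (s + 1) = if cyc k d s + 1 < k + d then cyc k d s + 1 else k := by
  by_cases h : s < k
  · rw [cyc_of_lt (show s < k + d by omega)]
    by_cases h' : s + 1 < k + d
    · rw [if_pos h', cyc_of_lt h']
    · omega
  · unfold cyc
    rw [if_neg (by omega), if_neg h, show s + 1 - k = s - k + 1 by omega, succ_mod_eq hd]
    split_ifs <;> omega

theorem cyc_eq_iff {s t : ℕ} (hs : k ≤ s) (ht : k ≤ t) :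
    cyc k d s = cyc k d t ↔ s ≡ t [MOD d] := by
  unfold cyc
  rw [if_neg (by omega), if_neg (by omega), Nat.add_left_cancel_iff]
  constructor
  · intro h
    have : s - k + k ≡ t - k + k [MOD d] := Nat.ModEq.add_right k h
    rwa [Nat.sub_add_cancel hs, Nat.sub_add_cancel ht] at this
  · intro h
    refine Nat.ModEq.add_right_cancel' k ?_
    rwa [Nat.sub_add_cancel hs, Nat.sub_add_cancel ht]

end cyc

/-! ### Necessary conditions on the letters of a realizing word. -/

/-- The conditions on the first `m` letters `c` of a word that realizes the pattern `P`. -/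
structure Compat (m : ℕ) (P c : ℕ → ℕ) : Prop where
  mono : ∀ i < m, ∀ j < m, P i < P j → c i ≤ c j
  step : ∀ i < m, ∀ j < m, P i < P j → c i = c j → P (i + 1) < P (j + 1)
  bottom : (∀ i < m, P m < P i) → P (m - 1) = P m + 1 → c (m - 1) ≠ 0

/-- The tails of `x` from positions `0, …, m` are in the same relative order as the values
of `P`. -/
def Realizes (m : ℕ) (x P : ℕ → ℕ) : Prop :=
  ∀ i ≤ m, ∀ j ≤ m, LexLt (tailAt x i) (tailAt x j) ↔ P i < P j

theorem Realizes.compat {m : ℕ} (hm : 0 < m) {x P : ℕ → ℕ} (h : Realizes m x P) :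
    Compat m P x where
  mono i hi j hj hij := by
    obtain ⟨t, h1, h2⟩ := (h i hi.le j hj.le).2 hij
    rcases Nat.eq_zero_or_pos t with rfl | ht
    · exact h2.le
    · exact (h1 0 ht).le
  step i hi j hj hij hx := by
    obtain ⟨t, h1, h2⟩ := (h i hi.le j hj.le).2 hij
    refine (h (i + 1) hi (j + 1) hj).1 ?_
    rcases t with _ | t
    · exact absurd h2 (by simp [tailAt, hx])
    · refine ⟨t, fun s hs => ?_, ?_⟩
      · have := h1 (s + 1) (by omega)
        simpa [tailAt, add_comm, add_left_comm] using this
      · simpa [tailAt, add_comm, add_left_comm] using h2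
  bottom _ hm' hx := by
    obtain ⟨t, h1, h2⟩ := (h m le_rfl (m - 1) (by omega)).2 (by omega)
    -- Tail m agrees with tail m - 1 before t, so a zero at m - 1 propagates up to t, and nothing is
    -- smaller than 0 there.
    have key : ∀ s ≤ t, x (m - 1 + s) = 0 := by
      intro s
      induction s with
      | zero => intro _; simpa using hx
      | succ s ih =>
        intro hs
        have := h1 s hs
        simp only [tailAt] at this
        rw [show m - 1 + (s + 1) = m + s by omega, this]
        exact ih (by omega)
    have := key t le_rfl
    simp only [tailAt] at h2
    omega

theorem not_injective_of_bounded {m : ℕ} (g : ℕ → ℕ) (hg : ∀ t, g t < m) :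
    ¬ Function.Injective g := by
  intro h
  refine not_injective_infinite_finite (fun t => (⟨g t, hg t⟩ : Fin m)) fun a b hab => h ?_
  simpa using hab

/-! ### Compatible letters yield a realizing word. -/

section realization

variable {k d : ℕ} {P c : ℕ → ℕ}

/-- On the cycle, the last position is followed by k instead of k + d. Since P k is the value just
above P (k + d), this substitution keeps every strict comparison except the one with k itself, where
the two positions merge. -/
theorem Compat.next_lt (hP : ∀ i ≤ k + d, ∀ j ≤ k + d, P i = P j → i = j)
    (hk : P k = P (k + d) + 1) (hc : Compat (k + d) P c)
    {i j : ℕ} (hi : i < k + d) (hj : j < k + d) (hij : P i < P j) (he : c i = c j) :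
    P (if i + 1 < k + d then i + 1 else k) < P (if j + 1 < k + d then j + 1 else k) ∨
      (i + 1 = k + d ∧ j + 1 = k) := by
  have h := hc.step i hi j hj hij he
  by_cases hi' : i + 1 < k + d
  · rw [if_pos hi']
    by_cases hj' : j + 1 < k + d
    · rw [if_pos hj']; exact Or.inl h
    · rw [if_neg hj']
      rw [show j + 1 = k + d by omega] at h
      exact Or.inl (by omega)
  · rw [if_neg hi']
    have hi2 : i + 1 = k + d := by omega
    rw [hi2] at h
    by_cases hj' : j + 1 < k + d
    · rw [if_pos hj']
      by_cases hjk : j + 1 = k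
      · exact Or.inr ⟨hi2, hjk⟩
      · left
        have : P k ≠ P (j + 1) := fun e => hjk (hP _ (by omega) _ (by omega) e).symm
        omega
    · rw [show j + 1 = k + d by omega] at h
      exact absurd h (lt_irrefl _)

/-- While letters agree, the strict order is transported along the cycle; once two positions have
merged they move together. -/
theorem Compat.cyc_lt_or_eq (hd : 0 < d) (hP : ∀ i ≤ k + d, ∀ j ≤ k + d, P i = P j → i = j)
    (hk : P k = P (k + d) + 1) (hc : Compat (k + d) P c)
    {i j : ℕ} (hi : i ≤ k + d) (hj : j ≤ k + d) (hij : P i < P j) (t : ℕ)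
    (he : ∀ s < t, c (cyc k d (i + s)) = c (cyc k d (j + s))) :
    P (cyc k d (i + t)) < P (cyc k d (j + t)) ∨
      (j < i ∧ cyc k d (i + t) = cyc k d (j + t) ∧ k ≤ j + t) := by
  induction t with
  | zero =>
    have hend : cyc k d (k + d) = k := by
      rw [cyc_add_period le_rfl, cyc_of_lt (by omega)]
    rw [add_zero, add_zero]
    rcases Nat.lt_or_ge i (k + d) with hi' | hi'
    · rw [cyc_of_lt hi']
      rcases Nat.lt_or_ge j (k + d) with hj' | hj'
      · rw [cyc_of_lt hj']; exact Or.inl hij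
      · obtain rfl : j = k + d := by omega
        rw [hend]; left; omega
    · obtain rfl : i = k + d := by omega
      have hj' : j < k + d := lt_of_le_of_ne hj (by rintro rfl; exact lt_irrefl _ hij)
      rw [hend, cyc_of_lt hj']
      by_cases hjk : j = k
      · right; omega
      · left
        have : P k ≠ P j := fun e => hjk (hP _ (by omega) _ (by omega) e).symm
        omega
  | succ t ih =>
    rcases ih fun s hs => he s (by omega) with h | ⟨h1, h2, h3⟩
    · have h' := hc.next_lt hP hk (cyc_lt hd _) (cyc_lt hd _) h (he t (by omega))
      rw [← add_assoc, ← add_assoc, cyc_succ hd, cyc_succ hd]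
      rcases h' with h' | ⟨h1, h2⟩
      · exact Or.inl h'
      · have hjk : j + t < k := by
          by_contra hcon
          have := le_cyc (d := d) (not_lt.1 hcon)
          omega
        have hj2 : cyc k d (j + t) = j + t := cyc_of_lt (by omega)
        have hij : j + t < i + t := by
          by_contra hcon
          rw [cyc_of_lt (show i + t < k + d by omega)] at h1
          omega
        right
        refine ⟨by omega, ?_, by omega⟩
        rw [if_neg (by omega), if_pos (by omega)]
        exact h2.symm
    · right
      rw [← add_assoc, ← add_assoc, cyc_succ hd, cyc_succ hd, h2]
      exact ⟨h1, rfl, by omega⟩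

/-- If the positions never merged, steps of length |i - j| would produce an infinite strictly
monotone chain of values of P on finitely many positions. -/
theorem Compat.lt_and_modEq_of_agree (hd : 0 < d)
    (hP : ∀ i ≤ k + d, ∀ j ≤ k + d, P i = P j → i = j) (hk : P k = P (k + d) + 1)
    (hc : Compat (k + d) P c)
    {i j : ℕ} (hi : i ≤ k + d) (hj : j ≤ k + d)
    (hij : P i < P j) (he : ∀ s, c (cyc k d (i + s)) = c (cyc k d (j + s))) :
    j < i ∧ j ≡ i [MOD d] := by
  have key := fun t => hc.cyc_lt_or_eq hd hP hk hi hj hij t fun s _ => he s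
  by_cases hex : ∃ t, j < i ∧ cyc k d (i + t) = cyc k d (j + t) ∧ k ≤ j + t
  · obtain ⟨t, h1, h2, h3⟩ := hex
    refine ⟨h1, ?_⟩
    have := (cyc_eq_iff (by omega) h3).1 h2
    exact (Nat.ModEq.add_right_cancel' t this).symm
  · exfalso
    have key' : ∀ t, P (cyc k d (i + t)) < P (cyc k d (j + t)) := fun t =>
      (key t).resolve_right fun h => hex ⟨t, h⟩
    rcases lt_trichotomy i j with h | h | h
    · refine not_injective_of_bounded (fun t => cyc k d (i + t * (j - i)))
        (fun t => cyc_lt hd _) ?_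
      refine Function.Injective.of_comp (f := P) (StrictMono.injective ?_)
      refine strictMono_nat_of_lt_succ fun t => ?_
      have := key' (t * (j - i))
      rwa [show j + t * (j - i) = i + (t + 1) * (j - i) by rw [add_mul]; omega] at this
    · subst h; exact lt_irrefl _ hij
    · refine not_injective_of_bounded (fun t => cyc k d (j + t * (i - j)))
        (fun t => cyc_lt hd _) ?_
      refine Function.Injective.of_comp (f := P) (StrictAnti.injective ?_)
      refine strictAnti_nat_of_succ_lt fun t => ?_
      have := key' (t * (i - j))
      rwa [show i + t * (i - j) = j + (t + 1) * (i - j) by rw [add_mul]; omega] at this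

/-- The periodic part of the word has no period shorter than `d`. -/
def PrimPart (c : ℕ → ℕ) (k d : ℕ) : Prop :=
  ∀ e, 0 < e → e < d → ¬ Function.Periodic (fun x => c (k + x % d)) e

theorem cyc_add_left (k d s : ℕ) : cyc k d (k + s) = k + s % d := by
  unfold cyc; rw [if_neg (by omega), Nat.add_sub_cancel_left]

/-- A shorter period e would make the periodic tails from k and k + e agree forever, forcing k ≡ k +
e modulo d. -/
theorem Compat.primPart (hd : 0 < d) (hP : ∀ i ≤ k + d, ∀ j ≤ k + d, P i = P j → i = j)
    (hk : P k = P (k + d) + 1) (hc : Compat (k + d) P c) : PrimPart c k d := by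
  intro e he0 hed hper
  have hne : P k ≠ P (k + e) := fun h => by
    have := hP _ (by omega) _ (by omega) h; omega
  have hag : ∀ s, c (cyc k d (k + s)) = c (cyc k d (k + e + s)) := by
    intro s
    rw [add_assoc, cyc_add_left, cyc_add_left, add_comm e]
    exact (hper s).symm
  have hmod : ¬ k ≡ k + e [MOD d] := by
    intro h
    have : 0 ≡ e [MOD d] := Nat.ModEq.add_left_cancel' k h
    have := (Nat.modEq_zero_iff_dvd.1 this.symm)
    exact absurd (Nat.le_of_dvd he0 this) (by omega)
  rcases lt_or_gt_of_ne hne with h | h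
  · exact hmod (hc.lt_and_modEq_of_agree hd hP hk (by omega) (by omega) h hag).2.symm
  · exact hmod (hc.lt_and_modEq_of_agree hd hP hk (by omega) (by omega) h
      fun s => (hag s).symm).2

theorem Compat.exists_ne_zero (hd : 0 < d) (hP : ∀ i ≤ k + d, ∀ j ≤ k + d, P i = P j → i = j)
    (hk : P k = P (k + d) + 1) (hc : Compat (k + d) P c) : ∃ r < d, c (k + r) ≠ 0 := by
  by_contra! hz
  -- An all-zero p has period 1, so primitivity leaves only length one.
  have hd1 : d = 1 := by
    by_contra hd1
    refine hc.primPart hd hP hk 1 one_pos (by omega) fun x => ?_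
    simp only
    rw [hz _ (Nat.mod_lt _ hd), hz _ (Nat.mod_lt _ hd)]
  subst hd1
  have hz0 : c k = 0 := hz 0 one_pos
  by_cases hb : ∀ i < k + 1, P (k + 1) < P i
  · exact hc.bottom hb (by simpa using hk) (by simpa using hz0)
  · push Not at hb
    obtain ⟨i, hi, hPi⟩ := hb
    -- A position with value below P (k + 1) also lies below k, hence has letter 0 = c k, so its
    -- successor again lies below P (k + 1). This ends in the absurd P (k + 1) < P (k + 1).
    have key : ∀ t, i + t ≤ k + 1 → P (i + t) < P (k + 1) := by
      intro t
      induction t with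
      | zero =>
        intro _
        refine lt_of_le_of_ne hPi fun e => ?_
        have := hP _ (by omega) _ le_rfl e
        omega
      | succ t ih =>
        intro ht
        have h := ih (by omega)
        have h1 : P (i + t) < P k := by omega
        have h2 := hc.mono (i + t) (by omega) k (by omega) h1
        exact hc.step (i + t) (by omega) k (by omega) h1 (by omega)
    have := key (k + 1 - i) (by omega)
    rw [show i + (k + 1 - i) = k + 1 by omega] at this
    exact lt_irrefl _ this

/-- The exponent k + d is large enough for tails starting at or before k + d to be compared over a
full period beyond the preperiod. -/
theorem length_bound (hd : 2 ≤ d) : k + d + d ≤ (k + d) * d := by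
  nlinarith [Nat.zero_le k]

/-- If two tails of `u p ^ ∞` agree on the part covered by `u p ^ (k + d)`, they are equal. -/
theorem agree_of_agree_lt (hd : 0 < d)
    {i j : ℕ} (hij : i < j) (hj : j ≤ k + d)
    (h : ∀ s, j + s < k + (k + d) * d → c (cyc k d (i + s)) = c (cyc k d (j + s))) (s : ℕ) :
    c (cyc k d (i + s)) = c (cyc k d (j + s)) := by
  rcases Nat.lt_or_ge d 2 with hd2 | hd2
  · obtain rfl : d = 1 := by omega
    rcases Nat.lt_or_ge (i + s) k with hs | hs
    · exact h s (by omega)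
    · congr 1
      exact (cyc_eq_iff hs (by omega)).2 (Nat.modEq_one)
  · have hL := length_bound (k := k) hd2
    induction s using Nat.strong_induction_on with
    | _ s ih =>
      by_cases hs : j + s < k + (k + d) * d
      · exact h s hs
      · have hs2 : k - i + d ≤ s := by omega
        obtain ⟨r, rfl⟩ : ∃ r, s = r + d := ⟨s - d, by omega⟩
        rw [← add_assoc, ← add_assoc, cyc_add_period (by omega), cyc_add_period (by omega)]
        exact ih r (by omega)

/-- The last nonzero letter of `u p ^ (k + d) 0 ^ ∞`. -/
theorem exists_last_ne_zero (hd : 0 < d)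
    (hnz : ∃ r < d, c (k + r) ≠ 0) :
    ∃ q, k + d ≤ q + 1 ∧ cycWord c k d q ≠ 0 ∧ ∀ s, q < s → cycWord c k d s = 0 := by
  classical
  obtain ⟨r, hr, hcr⟩ := hnz
  have hkd : 1 ≤ k + d := by omega
  obtain ⟨l, hl⟩ : ∃ l, k + d = l + 1 := ⟨k + d - 1, by omega⟩
  -- The nonzero letter in the last of the l + 1 copies of p.
  have hq0 : cycWord c k d (k + (r + d * l)) ≠ 0 := by
    unfold cycWord
    rw [if_pos (by rw [hl]; nlinarith), cyc_add_left, Nat.add_mul_mod_self_left,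
      Nat.mod_eq_of_lt hr]
    exact hcr
  have hbd : ∀ s, cycWord c k d s ≠ 0 → s ≤ k + (k + d) * d := by
    intro s hs
    by_contra hcon
    exact hs (if_neg (by omega))
  refine ⟨Nat.findGreatest (fun s => cycWord c k d s ≠ 0) (k + (k + d) * d), ?_, ?_, ?_⟩
  · have h1 := Nat.le_findGreatest (P := fun s => cycWord c k d s ≠ 0) (hbd _ hq0) hq0
    have h2 : l ≤ d * l := Nat.le_mul_of_pos_left _ hd
    omega
  · exact Nat.findGreatest_spec (P := fun s => cycWord c k d s ≠ 0) (hbd _ hq0) hq0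
  · intro s hs
    by_contra hcon
    exact absurd (Nat.le_findGreatest (P := fun s => cycWord c k d s ≠ 0) (hbd _ hcon) hcon)
      (by omega)

theorem Compat.lexLt_tailAt (hd : 0 < d) (hP : ∀ i ≤ k + d, ∀ j ≤ k + d, P i = P j → i = j)
    (hk : P k = P (k + d) + 1) (hc : Compat (k + d) P c)
    {i j : ℕ} (hi : i ≤ k + d) (hj : j ≤ k + d) (hij : P i < P j) :
    LexLt (tailAt (cycWord c k d) i) (tailAt (cycWord c k d) j) := by
  by_cases hag : ∀ s, c (cyc k d (i + s)) = c (cyc k d (j + s))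
  · obtain ⟨hji, -⟩ := hc.lt_and_modEq_of_agree hd hP hk hi hj hij hag
    obtain ⟨q, hq1, hq2, hq3⟩ := exists_last_ne_zero hd (hc.exists_ne_zero hd hP hk)
    -- Only the final zeros distinguish the two tails. As j < i, they set in earlier in tail i,
    -- which is thus pointwise at most tail j, with a difference where tail j reads the last nonzero
    -- letter.
    refine lexLt_of_first_ne ⟨q - j, ?_⟩ fun t _ => ?_
    · simp only [tailAt]
      rw [hq3 _ (by omega), show j + (q - j) = q by omega]
      exact hq2.symm
    · simp only [tailAt, cycWord]
      split_ifs
      · exact (hag t).le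
      · omega
      · exact Nat.zero_le _
      · exact le_rfl
  · have hex : ∃ s, i + s < k + (k + d) * d ∧ j + s < k + (k + d) * d ∧
        c (cyc k d (i + s)) ≠ c (cyc k d (j + s)) := by
      by_contra! hcon
      refine hag ?_
      rcases lt_trichotomy i j with h | h | h
      · exact agree_of_agree_lt hd h hj fun s hs => hcon s (by omega) hs
      · subst h; exact fun _ => rfl
      · exact fun s => (agree_of_agree_lt hd h hi (fun s hs => (hcon s hs (by omega)).symm) s).symm
    obtain ⟨s, h1, h2, h3⟩ := hex
    have hW : ∀ t ≤ s, tailAt (cycWord c k d) i t = c (cyc k d (i + t)) ∧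
        tailAt (cycWord c k d) j t = c (cyc k d (j + t)) := fun t ht =>
      ⟨if_pos (by omega), if_pos (by omega)⟩
    refine lexLt_of_first_ne ⟨s, by rw [(hW s le_rfl).1, (hW s le_rfl).2]; exact h3⟩
      fun t ht => ?_
    have hts : t ≤ s := by
      by_contra hcon
      have := ht s (by omega)
      rw [(hW s le_rfl).1, (hW s le_rfl).2] at this
      exact h3 this
    rw [(hW t hts).1, (hW t hts).2]
    have hag' : ∀ r < t, c (cyc k d (i + r)) = c (cyc k d (j + r)) := by
      intro r hr
      rw [← (hW r (by omega)).1, ← (hW r (by omega)).2]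
      exact ht r hr
    rcases hc.cyc_lt_or_eq hd hP hk hi hj hij t hag' with h | ⟨-, h, -⟩
    · exact hc.mono _ (cyc_lt hd _) _ (cyc_lt hd _) h
    · rw [h]

theorem Compat.realizes (hd : 0 < d) (hP : ∀ i ≤ k + d, ∀ j ≤ k + d, P i = P j → i = j)
    (hk : P k = P (k + d) + 1) (hc : Compat (k + d) P c) : Realizes (k + d) (cycWord c k d) P := by
  intro i hi j hj
  refine ⟨fun h => ?_, hc.lexLt_tailAt hd hP hk hi hj⟩
  by_contra hcon
  rcases (not_lt.1 hcon).eq_or_lt with e | e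
  · rw [hP _ hj _ hi e] at h
    exact LexLt.irrefl _ h
  · exact h.asymm (hc.lexLt_tailAt hd hP hk hj hi e)

end realization

/-! ### Words with a primitive nonzero periodic part. -/

section primitive

variable {k d : ℕ} {c : ℕ → ℕ}

/-- The place of the last nonzero letter within a tail determines where the tail starts. -/
theorem tailAt_cycWord_injOn (hd : 0 < d) (hnz : ∃ r < d, c (k + r) ≠ 0)
    {i j : ℕ} (hi : i ≤ k + d) (hj : j ≤ k + d)
    (h : tailAt (cycWord c k d) i = tailAt (cycWord c k d) j) : i = j := by
  obtain ⟨q, hq1, hq2, hq3⟩ := exists_last_ne_zero hd hnz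
  have key : ∀ i j, i < j → j ≤ k + d →
      tailAt (cycWord c k d) i ≠ tailAt (cycWord c k d) j := by
    intro i j hij hj h
    have := congrFun h (q - i)
    simp only [tailAt] at this
    rw [show i + (q - i) = q by omega, hq3 (j + (q - i)) (by omega)] at this
    exact hq2 this
  rcases lt_trichotomy i j with h' | h' | h'
  · exact absurd h (key i j h' hj)
  · exact h'
  · exact absurd h.symm (key j i h' hi)

/-- A whole number of periods later the letters are the same, but the final zeros come sooner. -/
theorem cycWord_le_shift {a b : ℕ} (ha : k ≤ a) (hab : a ≤ b) (h : a ≡ b [MOD d]) (s : ℕ) :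
    tailAt (cycWord c k d) b s ≤ tailAt (cycWord c k d) a s := by
  simp only [tailAt, cycWord]
  split_ifs
  · rw [(cyc_eq_iff (by omega) (by omega)).2 (Nat.ModEq.add_right s h)]
  · omega
  · exact Nat.zero_le _
  · exact le_rfl

theorem lexLt_of_le_of_ne {x y : ℕ → ℕ} (h : ∀ s, x s ≤ y s) (hne : x ≠ y) : LexLt x y :=
  lexLt_of_first_ne (Function.ne_iff.1 hne) fun t _ => h t

theorem lexLt_tailAt_last (hd : 0 < d) (hnz : ∃ r < d, c (k + r) ≠ 0) :
    LexLt (tailAt (cycWord c k d) (k + d)) (tailAt (cycWord c k d) k) := by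
  refine lexLt_of_le_of_ne (cycWord_le_shift le_rfl (by omega) (by simp [Nat.ModEq])) fun h => ?_
  have := tailAt_cycWord_injOn hd hnz le_rfl (by omega) h
  omega

theorem LexLt.agree_of_between {x y z : ℕ → ℕ} {T : ℕ} (hxy : LexLt x y) (hyz : LexLt y z)
    (h : ∀ s < T, x s = z s) : ∀ s < T, y s = z s := by
  obtain ⟨t₁, h1, h1'⟩ := hxy
  obtain ⟨t₂, h2, h2'⟩ := hyz
  intro s hs
  refine h2 s ?_
  by_contra hcon
  rcases lt_trichotomy t₁ t₂ with ht | ht | ht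
  · have := h t₁ (by omega); have := h2 t₁ ht; omega
  · subst ht; have := h t₁ (by omega); omega
  · have := h t₂ (by omega); have := h1 t₂ ht; omega

/-- No tail of `u p ^ (k + d) 0 ^ ∞` from a position at most `k + d` lies strictly between the
tails from the positions `k + d` and `k`. -/
theorem not_between_of_primPart (hd : 0 < d)
    (hprim : PrimPart c k d) {i : ℕ} (hi : i ≤ k + d)
    (h1 : LexLt (tailAt (cycWord c k d) (k + d)) (tailAt (cycWord c k d) i))
    (h2 : LexLt (tailAt (cycWord c k d) i) (tailAt (cycWord c k d) k)) : False := by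
  have hik : i ≠ k := by rintro rfl; exact LexLt.irrefl _ h2
  have hikd : i ≠ k + d := by rintro rfl; exact LexLt.irrefl _ h1
  have hi' : i < k + d := lt_of_le_of_ne hi hikd
  have hper : ∀ s, cyc k d (k + d + s) = cyc k d (k + s) := fun s => by
    rw [add_right_comm, cyc_add_period (by omega)]
  -- The tails from k + d and k share the prefix p^(k+d-1), hence so does any tail caught between
  -- them.
  have hag := h1.agree_of_between h2 (T := k + (k + d) * d - (k + d)) fun s hs => by
    simp only [tailAt, cycWord]
    rw [if_pos (by omega), if_pos (by omega), hper]
  have hag' := agree_of_agree_lt hd hi' le_rfl (c := c) fun s hs => by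
    have := hag s (by omega)
    simp only [tailAt, cycWord] at this
    rwa [if_pos (by omega), if_pos (by omega), ← hper] at this
  rcases lt_or_gt_of_ne hik with h | h
  -- For i < k, tail i reads the same periodic letters as tail k but its zeros start later, so it
  -- cannot be smaller.
  · refine h2.asymm (lexLt_of_le_of_ne (fun s => ?_) fun e => ?_)
    · simp only [tailAt, cycWord]
      split_ifs
      · rw [hag' s, hper]
      · omega
      · exact Nat.zero_le _
      · exact le_rfl
    · rw [e] at h2
      exact LexLt.irrefl _ h2
  -- For i > k, the agreement is a period i - k < d of p.
  · refine hprim (i - k) (by omega) (by omega) fun s => ?_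
    have := hag' s
    rw [hper, cyc_add_left, show i + s = k + (s + (i - k)) by omega, cyc_add_left] at this
    exact this

end primitive

/-! ### Primitive finite words and powers. -/

section words

variable {α : Type*}

theorem wordPow_succ (u : List α) (m : ℕ) : wordPow u (m + 1) = u ++ wordPow u m := by
  simp [wordPow, List.replicate_succ]

theorem length_wordPow (u : List α) (m : ℕ) : (wordPow u m).length = m * u.length := by
  simp [wordPow]

theorem getElem?_wordPow (u : List α) (m s : ℕ) (hs : s < m * u.length) :
    (wordPow u m)[s]? = u[s % u.length]? := by
  induction m generalizing s with
  | zero => omega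
  | succ m ih =>
    rw [wordPow_succ]
    rcases Nat.lt_or_ge s u.length with h | h
    · rw [List.getElem?_append_left h, Nat.mod_eq_of_lt h]
    · rw [List.getElem?_append_right h, ih _ (by rw [add_mul] at hs; omega), ← Nat.mod_eq_sub_mod h]

theorem periodic_mod {q : ℕ → α} {e d : ℕ} (he : Function.Periodic q e)
    (hd : Function.Periodic q d) : Function.Periodic q (d % e) := by
  intro x
  have h1 : q (x + d % e + (d / e) * e) = q (x + d % e) := he.nat_mul (d / e) (x + d % e)
  rw [← h1, add_assoc, Nat.mod_add_div']
  exact hd x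

/-- The least period g of the d-periodic extension divides d, since d % g is again a period; a
period shorter than d therefore exhibits the word as a proper power. -/
theorem isPrimitiveWord_ofFn_iff {d : ℕ} (hd : 0 < d) (f : Fin d → α) :
    IsPrimitiveWord (List.ofFn f) ↔
      ∀ e, 0 < e → e < d → ¬ Function.Periodic (fun x => f ⟨x % d, Nat.mod_lt x hd⟩) e := by
  classical
  set q : ℕ → α := fun x => f ⟨x % d, Nat.mod_lt x hd⟩ with hq
  have hqd : Function.Periodic q d := fun x => by simp [hq]
  have hget : ∀ x, (List.ofFn f)[x % d]? = some (q x) := fun x => by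
    rw [List.getElem?_ofFn, dif_pos (Nat.mod_lt x hd)]
  constructor
  · intro hprim e he0 hed hper
    have hex : ∃ e, 0 < e ∧ Function.Periodic q e := ⟨e, he0, hper⟩
    obtain ⟨hg0, hgp⟩ := Nat.find_spec hex
    have hge : Nat.find hex ≤ e := Nat.find_min' hex ⟨he0, hper⟩
    set g := Nat.find hex
    have hgd : g ∣ d := by
      refine Nat.dvd_of_mod_eq_zero (Nat.eq_zero_of_not_pos fun hpos => ?_)
      exact Nat.find_min hex (Nat.mod_lt d hg0) ⟨hpos, periodic_mod hgp hqd⟩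
    obtain ⟨m, hm⟩ := hgd
    have hm1 : 1 < m := by
      by_contra hcon
      have : g * m ≤ g * 1 := Nat.mul_le_mul_left g (by omega)
      omega
    refine hprim (List.ofFn fun r : Fin g => q r) m hm1 (List.ext_getElem? fun s => ?_)
    rcases Nat.lt_or_ge s d with hs | hs
    · rw [getElem?_wordPow _ _ _ (by rw [List.length_ofFn, mul_comm, ← hm]; exact hs),
        List.length_ofFn, List.getElem?_ofFn (i := s % g), dif_pos (Nat.mod_lt s hg0)]
      have h1 := hgp.nat_mul (s / g) (s % g)
      simp only [Nat.cast_id] at h1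
      rw [Nat.mod_add_div'] at h1
      have h2 := hget s
      rw [Nat.mod_eq_of_lt hs] at h2
      rw [h2, h1]
    · rw [List.getElem?_eq_none (by simpa using hs), List.getElem?_eq_none]
      rw [length_wordPow, List.length_ofFn, mul_comm, ← hm]; exact hs
  · intro h u m hm hu
    have hlen : d = m * u.length := by
      rw [← length_wordPow, ← hu, List.length_ofFn]
    have hu0 : 0 < u.length := Nat.pos_of_ne_zero fun h0 => by rw [h0] at hlen; omega
    refine h u.length hu0 (by nlinarith) fun x => ?_
    have key : ∀ x, some (q x) = u[x % u.length]? := fun x => by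
      rw [← hget, hu, getElem?_wordPow _ _ _ (by rw [← hlen]; exact Nat.mod_lt x hd),
        Nat.mod_mod_of_dvd _ ⟨m, by rw [hlen, mul_comm]⟩]
    have := key (x + u.length)
    rw [Nat.add_mod_right, ← key] at this
    exact Option.some.inj this

theorem getD_take_append_wordPow {k d : ℕ} (hd : 0 < d) (l : List ℕ) (hl : l.length = k + d)
    (s : ℕ) :
    (l.take k ++ wordPow (l.drop k) (k + d)).getD s 0 = cycWord (fun r => l.getD r 0) k d s := by
  have hdl : (l.drop k).length = d := by rw [List.length_drop, hl]; omega
  have htl : (l.take k).length = k := by rw [List.length_take, hl]; omega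
  rw [List.getD_eq_getElem?_getD]
  unfold cycWord cyc
  rcases Nat.lt_or_ge s k with h | h
  · have : 0 < (k + d) * d := by positivity
    rw [List.getElem?_append_left (by omega), if_pos (by omega), if_pos h,
      List.getElem?_take_of_lt h, ← List.getD_eq_getElem?_getD]
  · rw [List.getElem?_append_right (by omega), htl]
    split_ifs with h1 h2
    · omega
    · rw [getElem?_wordPow _ _ _ (by rw [hdl]; omega), hdl, List.getElem?_drop,
        ← List.getD_eq_getElem?_getD]
    · rw [List.getElem?_eq_none (by rw [length_wordPow, hdl]; omega), Option.getD_none]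

end words

/-! ### The least compatible sequence of letters. -/

section letters

variable {m : ℕ} (π : Equiv.Perm (Fin (m + 1)))

/-- The entries of `π`, as numbers from `1` to `m + 1`, at positions numbered from zero. -/
def pv (i : ℕ) : ℕ := entry π (i + 1)

theorem pv_eq {i : ℕ} (hi : i ≤ m) : pv π i = (π ⟨i, by omega⟩ : ℕ) + 1 := by
  unfold pv entry
  rw [dif_pos (by omega)]
  rfl

theorem pv_pos {i : ℕ} (hi : i ≤ m) : 1 ≤ pv π i := by rw [pv_eq π hi]; omega

theorem pv_le {i : ℕ} (hi : i ≤ m) : pv π i ≤ m + 1 := by rw [pv_eq π hi]; omega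

theorem pv_inj : ∀ i ≤ m, ∀ j ≤ m, pv π i = pv π j → i = j := by
  intro i hi j hj h
  rw [pv_eq π hi, pv_eq π hj] at h
  have h1 := π.injective (Fin.ext (Nat.succ_injective h))
  simpa using h1

theorem exists_pv_eq {v : ℕ} (h1 : 1 ≤ v) (h2 : v ≤ m + 1) : ∃ i ≤ m, pv π i = v := by
  refine ⟨π.symm ⟨v - 1, by omega⟩, by omega, ?_⟩
  rw [pv_eq π (by omega)]
  simp only [Fin.eta, Equiv.apply_symm_apply]
  omega

theorem exists_lt_pv_eq {v : ℕ} (h1 : 1 ≤ v) (h2 : v ≤ m + 1) (h3 : v ≠ pv π m) :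
    ∃ i < m, pv π i = v := by
  obtain ⟨i, hi, h⟩ := exists_pv_eq π h1 h2
  exact ⟨i, lt_of_le_of_ne hi (by rintro rfl; exact h3 h.symm), h⟩

theorem pv_ne_last {i : ℕ} (hi : i < m) : pv π i ≠ pv π m := fun h => by
  have := pv_inj π i hi.le m le_rfl h; omega

theorem mem_descSet_iff {a : ℕ} : a ∈ descSet π ↔
    ∃ i < m, ∃ j < m, pv π i = a ∧ pv π j = a + 1 ∧ pv π (j + 1) < pv π (i + 1) := by
  simp only [descSet, Finset.mem_filter, Finset.mem_Icc, add_tsub_cancel_right]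
  constructor
  · rintro ⟨-, i, hi, j, hj, h1, h2, h3⟩
    obtain ⟨i, rfl⟩ : ∃ i', i = i' + 1 := ⟨i - 1, by omega⟩
    obtain ⟨j, rfl⟩ : ∃ j', j = j' + 1 := ⟨j - 1, by omega⟩
    exact ⟨i, by omega, j, by omega, h1, h2, h3⟩
  · rintro ⟨i, hi, j, hj, h1, h2, h3⟩
    have := pv_pos π hi.le
    have := pv_le π hj.le
    exact ⟨⟨by omega, by omega⟩, i + 1, by omega, j + 1, by omega, h1, h2, h3⟩

theorem mem_descSet_pv_iff {i j : ℕ} (hi : i < m) (hj : j < m) (hij : pv π j = pv π i + 1) :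
    pv π i ∈ descSet π ↔ pv π (j + 1) < pv π (i + 1) := by
  rw [mem_descSet_iff]
  constructor
  · rintro ⟨i', hi', j', hj', h1, h2, h3⟩
    obtain rfl := pv_inj π _ hi'.le _ hi.le h1
    obtain rfl := pv_inj π _ hj'.le _ hj.le (h2.trans hij.symm)
    exact h3
  · exact fun h => ⟨i, hi, j, hj, rfl, hij, h⟩

theorem last_notMem_descSet : pv π m ∉ descSet π := by
  rw [mem_descSet_iff]
  rintro ⟨i, hi, -, -, h, -⟩
  exact pv_ne_last π hi h

theorem ne_last_of_mem_descSet {a : ℕ} (ha : a ∈ descSet π) : a + 1 ≠ pv π m := by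
  rw [mem_descSet_iff] at ha
  obtain ⟨-, -, j, hj, -, h, -⟩ := ha
  rw [← h]
  exact pv_ne_last π hj

theorem one_le_of_mem_descSet {a : ℕ} (ha : a ∈ descSet π) : 1 ≤ a := by
  rw [mem_descSet_iff] at ha
  obtain ⟨i, hi, -, -, h, -⟩ := ha
  rw [← h]
  exact pv_pos π hi.le

theorem middleCase_iff {i j : ℕ} (hi : i < m) (hj : j < m) (h1 : pv π i + 1 = pv π m)
    (h2 : pv π j = pv π m + 1) : MiddleCase π ↔ pv π (j + 1) < pv π (i + 1) := by
  constructor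
  · rintro ⟨-, -, i', hi', j', hj', h1', h2', h3'⟩
    simp only [Finset.mem_Icc, add_tsub_cancel_right] at hi' hj'
    obtain ⟨i', rfl⟩ : ∃ i'', i' = i'' + 1 := ⟨i' - 1, by omega⟩
    obtain ⟨j', rfl⟩ : ∃ j'', j' = j'' + 1 := ⟨j' - 1, by omega⟩
    change pv π i' + 1 = pv π m at h1'
    change pv π j' = pv π m + 1 at h2'
    obtain rfl := pv_inj π i' (by omega) i hi.le (by omega)
    obtain rfl := pv_inj π j' (by omega) j hj.le (by omega)
    exact h3'
  · intro h
    have := pv_pos π hi.le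
    have := pv_le π hj.le
    refine ⟨?_, ?_, i + 1, by simp; omega, j + 1, by simp; omega, h1, h2, h⟩
    · change pv π m ≠ 1; omega
    · change pv π m ≠ m + 1; omega

theorem bottomCase_iff (hm : 0 < m) : BottomCase π ↔ pv π m = 1 ∧ pv π (m - 1) = 2 := by
  unfold BottomCase pv
  rw [show m + 1 - 1 = m - 1 + 1 by omega]

/-- The letter assigned to the position `i`, numbered from zero. -/
noncomputable def letterAt (i : ℕ) : ℕ := letter π (i + 1)

theorem letterAt_mono {i j : ℕ} (h : pv π i ≤ pv π j) : letterAt π i ≤ letterAt π j := by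
  classical
  unfold letterAt letter
  change entry π (i + 1) ≤ entry π (j + 1) at h
  refine add_le_add (add_le_add le_rfl (Finset.card_le_card ?_)) ?_
  · intro a ha
    rw [Finset.mem_filter] at ha ⊢
    exact ⟨ha.1, ha.2.trans h⟩
  · by_cases h1 : MiddleCase π ∧ entry π (m + 1) + 1 ≤ entry π (i + 1)
    · rw [if_pos h1, if_pos ⟨h1.1, h1.2.trans h⟩]
    · rw [if_neg h1]; exact Nat.zero_le _

open Classical in
theorem letterAt_step {i j : ℕ} (hi : i < m) (hij : pv π j = pv π i + 1) :
    letterAt π j = letterAt π i + if pv π i ∈ descSet π then 1 else 0 := by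
  have hb := pv_ne_last π hi
  have hcard : {a ∈ descSet π | a + 1 ≤ pv π j}.card =
      {a ∈ descSet π | a + 1 ≤ pv π i}.card + if pv π i ∈ descSet π then 1 else 0 := by
    rw [hij]
    split_ifs with h
    · rw [← Finset.card_insert_of_notMem (a := pv π i) (by simp)]
      congr 1
      ext a
      simp only [Finset.mem_filter, Finset.mem_insert]
      constructor
      · rintro ⟨h1, h2⟩
        rcases Nat.lt_or_ge a (pv π i) with h3 | h3
        · exact Or.inr ⟨h1, h3⟩
        · exact Or.inl (by omega)
      · rintro (rfl | ⟨h1, h2⟩)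
        · exact ⟨h, le_rfl⟩
        · exact ⟨h1, by omega⟩
    · rw [add_zero]
      congr 1
      refine Finset.filter_congr fun a ha => ?_
      have : a ≠ pv π i := by rintro rfl; exact h ha
      omega
  have hmid : (MiddleCase π ∧ pv π m + 1 ≤ pv π j) ↔ (MiddleCase π ∧ pv π m + 1 ≤ pv π i) :=
    and_congr_right fun _ => by omega
  change _ + {a ∈ descSet π | a + 1 ≤ pv π j}.card +
      (if MiddleCase π ∧ pv π m + 1 ≤ pv π j then 1 else 0) =
    _ + {a ∈ descSet π | a + 1 ≤ pv π i}.card +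
      (if MiddleCase π ∧ pv π m + 1 ≤ pv π i then 1 else 0) + _
  rw [hcard, if_congr hmid rfl rfl]
  ring

open Classical in
theorem letterAt_gap {i j : ℕ} (h1 : pv π i + 1 = pv π m) (h2 : pv π j = pv π m + 1) :
    letterAt π j = letterAt π i + if MiddleCase π then 1 else 0 := by
  have hcard : {a ∈ descSet π | a + 1 ≤ pv π j} = {a ∈ descSet π | a + 1 ≤ pv π i} := by
    refine Finset.filter_congr fun a ha => ?_
    have : a ≠ pv π m := by rintro rfl; exact last_notMem_descSet π ha
    have := ne_last_of_mem_descSet π ha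
    omega
  change _ + {a ∈ descSet π | a + 1 ≤ pv π j}.card +
      (if MiddleCase π ∧ pv π m + 1 ≤ pv π j then 1 else 0) =
    _ + {a ∈ descSet π | a + 1 ≤ pv π i}.card +
      (if MiddleCase π ∧ pv π m + 1 ≤ pv π i then 1 else 0) + _
  rw [hcard, if_neg (show ¬ (MiddleCase π ∧ pv π m + 1 ≤ pv π i) by omega), add_zero]
  congr 1
  exact if_congr (and_iff_left (by omega)) rfl rfl

open Classical in
theorem letterAt_min {i : ℕ} (h : pv π i = 1 ∨ pv π m = 1 ∧ pv π i = 2) :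
    letterAt π i = if BottomCase π then 1 else 0 := by
  have hcard : {a ∈ descSet π | a + 1 ≤ pv π i} = ∅ := by
    refine Finset.filter_eq_empty_iff.2 fun a ha => ?_
    have : a ≠ pv π m := by rintro rfl; exact last_notMem_descSet π ha
    have := one_le_of_mem_descSet π ha
    omega
  have hmid : ¬ (MiddleCase π ∧ pv π m + 1 ≤ pv π i) := by
    rintro ⟨⟨h1, -⟩, h2⟩
    change pv π m ≠ 1 at h1
    have := pv_pos π (le_refl m)
    omega
  change _ + {a ∈ descSet π | a + 1 ≤ pv π i}.card +
      (if MiddleCase π ∧ pv π m + 1 ≤ pv π i then 1 else 0) = _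
  rw [hcard, if_neg hmid]
  simp

/-- Sort the positions below m by value: neighbours differ by 1, except across the missing value `pv
π m`. A transitive relation needs checking only on these two kinds of neighbours. -/
theorem chain_induction {R : ℕ → ℕ → Prop}
    (hstep : ∀ i < m, ∀ j < m, pv π j = pv π i + 1 → R i j)
    (hgap : ∀ i < m, ∀ j < m, pv π i + 1 = pv π m → pv π j = pv π m + 1 → R i j)
    (htrans : ∀ i < m, ∀ j < m, ∀ l < m, pv π i < pv π j → pv π j < pv π l →
      R i j → R j l → R i l)
    (i : ℕ) (hi : i < m) (j : ℕ) (hj : j < m) (hij : pv π i < pv π j) : R i j := by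
  induction hv : pv π j using Nat.strong_induction_on generalizing j with
  | _ v ih =>
    subst hv
    have hi1 := pv_pos π hi.le
    have hj1 := pv_le π hj.le
    by_cases h1 : pv π j = pv π i + 1
    · exact hstep i hi j hj h1
    by_cases h2 : pv π j = pv π m + 1
    · by_cases h3 : pv π i + 1 = pv π m
      · exact hgap i hi j hj h3 h2
      · have := pv_ne_last π hi
        obtain ⟨l, hl, hpl⟩ := exists_lt_pv_eq π (v := pv π m - 1) (by omega) (by omega) (by omega)
        exact htrans i hi l hl j hj (by omega) (by omega)
          (ih (pv π l) (by omega) l hl (by omega) rfl)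
          (hgap l hl j hj (by omega) h2)
    · obtain ⟨l, hl, hpl⟩ := exists_lt_pv_eq π (v := pv π j - 1) (by omega) (by omega) (by omega)
      exact htrans i hi l hl j hj (by omega) (by omega)
        (ih (pv π l) (by omega) l hl (by omega) rfl)
        (hstep l hl j hj (by omega))

theorem exists_min_position (hm : 0 < m) :
    ∃ i < m, (pv π i = 1 ∨ pv π m = 1 ∧ pv π i = 2) ∧ ∀ j < m, pv π i ≤ pv π j := by
  by_cases hb : pv π m = 1
  · obtain ⟨i, hi, h⟩ := exists_lt_pv_eq π (v := 2) (by omega) (by omega) (by omega)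
    refine ⟨i, hi, Or.inr ⟨hb, h⟩, fun j hj => ?_⟩
    have := pv_pos π hj.le
    have := pv_ne_last π hj
    omega
  · obtain ⟨i, hi, h⟩ := exists_lt_pv_eq π (v := 1) (by omega) (by omega) (by omega)
    refine ⟨i, hi, Or.inl h, fun j hj => ?_⟩
    have := pv_pos π hj.le
    omega

/-- The compatible sequences of letters are the assigned one plus a nonnegative sequence that is
increasing along `π`. -/
theorem compat_iff (hm : 0 < m) (c : ℕ → ℕ) : Compat m (pv π) c ↔
    (∀ i < m, letterAt π i ≤ c i) ∧
      ∀ i < m, ∀ j < m, pv π i < pv π j → c i + letterAt π j ≤ c j + letterAt π i := by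
  constructor
  · intro hc
    have key : ∀ i < m, ∀ j < m, pv π i < pv π j → c i + letterAt π j ≤ c j + letterAt π i := by
      refine chain_induction π ?_ ?_ ?_
      · intro i hi j hj hij
        have h1 := hc.mono i hi j hj (by omega)
        rw [letterAt_step π hi hij]
        split_ifs with h
        · rw [mem_descSet_pv_iff π hi hj hij] at h
          have : c i ≠ c j := fun e => by
            have := hc.step i hi j hj (by omega) e; omega
          omega
        · omega
      · intro i hi j hj h1 h2
        have h3 := hc.mono i hi j hj (by omega)
        rw [letterAt_gap π h1 h2]
        split_ifs with h
        · rw [middleCase_iff π hi hj h1 h2] at h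
          have : c i ≠ c j := fun e => by
            have := hc.step i hi j hj (by omega) e; omega
          omega
        · omega
      · intros; omega
    refine ⟨fun i hi => ?_, key⟩
    obtain ⟨i₀, hi₀, hmin, hle⟩ := exists_min_position π hm
    have h0 : letterAt π i₀ ≤ c i₀ := by
      rw [letterAt_min π hmin]
      split_ifs with h
      · rw [bottomCase_iff π hm] at h
        -- In the bottom case the least position is m - 1, and the condition `bottom` supplies the
        -- required letter 1.
        obtain rfl : i₀ = m - 1 := pv_inj π _ hi₀.le _ (by omega) (by
          have := pv_ne_last π hi₀; omega)
        have := hc.bottom (fun i hi => by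
          have := pv_pos π hi.le
          have := pv_ne_last π hi
          omega) (by omega)
        omega
      · exact Nat.zero_le _
    rcases (hle i hi).eq_or_lt with h | h
    · rwa [← pv_inj π _ hi₀.le _ hi.le h]
    · have := key i₀ hi₀ i hi h
      omega
  · rintro ⟨hle, hmono⟩
    -- By monotonicity, equal letters at two ends of the chain are equal all along it, so no descent
    -- occurs between them.
    have hstep : ∀ i < m, ∀ j < m, pv π i < pv π j →
        (letterAt π i = letterAt π j → pv π (i + 1) < pv π (j + 1)) := by
      have hlt : ∀ i < m, ∀ j < m, pv π i < pv π j → ¬ pv π (j + 1) < pv π (i + 1) →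
          pv π (i + 1) < pv π (j + 1) := by
        intro i hi j hj hij h
        refine lt_of_le_of_ne (not_lt.1 h) fun e => ?_
        have := pv_inj π (i + 1) hi (j + 1) hj e
        obtain rfl : i = j := by omega
        exact lt_irrefl _ hij
      refine chain_induction π ?_ ?_ ?_
      · intro i hi j hj hij he
        refine hlt i hi j hj (by omega) ?_
        rw [← mem_descSet_pv_iff π hi hj hij]
        intro h
        rw [letterAt_step π hi hij, if_pos h] at he
        omega
      · intro i hi j hj h1 h2 he
        refine hlt i hi j hj (by omega) ?_
        rw [← middleCase_iff π hi hj h1 h2]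
        intro h
        rw [letterAt_gap π h1 h2, if_pos h] at he
        omega
      · intro i _ j _ l _ hij hjl h1 h2 he
        have := letterAt_mono π hij.le
        have := letterAt_mono π hjl.le
        exact (h1 (by omega)).trans (h2 (by omega))
    refine ⟨fun i hi j hj hij => ?_, fun i hi j hj hij he => ?_, fun hbot hb => ?_⟩
    · have := hmono i hi j hj hij
      have := letterAt_mono π hij.le
      omega
    · have := hmono i hi j hj hij
      have := letterAt_mono π hij.le
      exact hstep i hi j hj hij (by omega)
    · have h1 : pv π m = 1 := by
        obtain ⟨l, hl, h⟩ := exists_pv_eq π (v := 1) le_rfl (by omega)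
        rcases hl.eq_or_lt with rfl | hl
        · exact h
        · have := hbot l hl
          have := pv_pos π (le_refl m)
          omega
      have h2 := hle (m - 1) (by omega)
      rw [letterAt_min π (Or.inr ⟨h1, by omega⟩),
        if_pos ((bottomCase_iff π hm).2 ⟨h1, by omega⟩)] at h2
      omega

theorem compat_letterAt (hm : 0 < m) : Compat m (pv π) (letterAt π) :=
  (compat_iff π hm _).2 ⟨fun _ _ => le_rfl, fun _ _ _ _ _ => by omega⟩

end letters

/-! ### The value of N(π) and injectivity of w_A. -/

section realize

variable {m : ℕ} (π : Equiv.Perm (Fin (m + 1)))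

theorem iterate_shift (N i : ℕ) (w : Word N) :
    (shift N)^[i] w = toLex fun s => ofLex w (i + s) := by
  induction i generalizing w with
  | zero => simp only [Function.iterate_zero, id, zero_add]; rfl
  | succ i ih =>
    rw [Function.iterate_succ_apply, ih]
    simp only [shift, ofLex_toLex]
    congr 1
    funext s
    rw [show i + 1 + s = i + s + 1 by omega]

theorem toLex_lt_iff {N : ℕ} (x y : ℕ → Fin N) :
    toLex x < toLex y ↔ LexLt (fun s => x s) (fun s => y s) := by
  constructor
  · rintro ⟨t, h1, h2⟩
    exact ⟨t, fun s hs => congrArg Fin.val (h1 s hs), h2⟩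
  · rintro ⟨t, h1, h2⟩
    exact ⟨t, fun s hs => Fin.ext (h1 s hs), h2⟩

theorem isPat_iff {N : ℕ} (w : Word N) :
    IsPat (shift N) w π ↔ Realizes m (fun s => (ofLex w s : ℕ)) (pv π) := by
  have key : ∀ i j : Fin (m + 1), ((shift N)^[(i : ℕ)] w < (shift N)^[(j : ℕ)] w ↔ π i < π j) ↔
      (LexLt (tailAt (fun s => (ofLex w s : ℕ)) i) (tailAt (fun s => (ofLex w s : ℕ)) j) ↔
        pv π i < pv π j) := by
    intro i j
    rw [iterate_shift, iterate_shift, toLex_lt_iff, pv_eq π (by omega), pv_eq π (by omega),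
      Nat.add_lt_add_iff_right]
    rfl
  constructor
  · intro h i hi j hj
    exact (key ⟨i, by omega⟩ ⟨j, by omega⟩).1 (h _ _)
  · intro h i j
    exact (key i j).2 (h i (by omega) j (by omega))

theorem mem_allowed_iff_exists (N : ℕ) : π ∈ allowed (shift N) (m + 1) ↔
    ∃ x : ℕ → ℕ, (∀ s, x s < N) ∧ Realizes m x (pv π) := by
  constructor
  · rintro ⟨w, hw⟩
    exact ⟨_, fun s => (ofLex w s).2, (isPat_iff π w).1 hw⟩
  · rintro ⟨x, hx, h⟩
    exact ⟨toLex fun s => ⟨x s, hx s⟩, (isPat_iff π _).2 h⟩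

/-- A word determines its pattern; injectivity of w_A and of the double count both rest on this. -/
theorem eq_of_realizes {π σ : Equiv.Perm (Fin (m + 1))} {x : ℕ → ℕ}
    (h1 : Realizes m x (pv π)) (h2 : Realizes m x (pv σ)) : π = σ := by
  have key : ∀ i j, π i < π j ↔ σ i < σ j := by
    intro i j
    have := (h1 i (by omega) j (by omega)).symm.trans (h2 i (by omega) j (by omega))
    rw [pv_eq, pv_eq, pv_eq, pv_eq] at this <;> try omega
    simpa using this
  have hmono : StrictMono (σ ∘ π.symm) := by
    intro a b hab
    exact (key _ _).1 (by simpa using hab)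
  ext i
  -- A strictly increasing self-map of a finite chain lies both above and below the identity.
  have h : σ (π.symm (π i)) = π i := le_antisymm hmono.apply_le hmono.le_apply
  rw [Equiv.symm_apply_apply] at h
  rw [h]

theorem cycWord_congr {c c' : ℕ → ℕ} {k d : ℕ} (hd : 0 < d) (h : ∀ r < k + d, c r = c' r) :
    cycWord c k d = cycWord c' k d := by
  funext s
  unfold cycWord
  rw [h _ (cyc_lt hd s)]

/-- The letter at the position of the largest entry. -/
noncomputable def topLetter : ℕ := letterAt π (π.symm (Fin.last m))

variable {π}

theorem exists_split (hb : pv π m ≠ m + 1) : ∃ k < m, pv π k = pv π m + 1 := by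
  have := pv_le π (le_refl m)
  exact exists_lt_pv_eq π (by omega) (by omega) (by omega)

theorem exists_top (hb : pv π m ≠ m + 1) :
    ∃ i < m, pv π i = m + 1 ∧ letterAt π i = topLetter π := by
  have h : pv π (π.symm (Fin.last m)) = m + 1 := by
    rw [pv_eq π (by omega)]; simp
  refine ⟨π.symm (Fin.last m), ?_, h, rfl⟩
  refine lt_of_le_of_ne (by omega) fun e => hb ?_
  rwa [e] at h

theorem letterAt_le_top (hb : pv π m ≠ m + 1) {i : ℕ} (hi : i ≤ m) :
    letterAt π i ≤ topLetter π := by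
  obtain ⟨j, _, h1, h2⟩ := exists_top hb
  rw [← h2]
  exact letterAt_mono π (by rw [h1]; exact pv_le π hi)

/-- Every realizing word dominates `letterAt π` on its first m letters, while `cycWord (letterAt π)`
realizes π using only these letters and 0. -/
theorem mem_allowed_iff (hb : pv π m ≠ m + 1) (N : ℕ) :
    π ∈ allowed (shift N) (m + 1) ↔ topLetter π < N := by
  obtain ⟨k, hk, hpk⟩ := exists_split hb
  have hm : 0 < m := by omega
  rw [mem_allowed_iff_exists]
  constructor
  · rintro ⟨x, hx, h⟩
    obtain ⟨j, hj, -, h2⟩ := exists_top hb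
    rw [← h2]
    exact (((compat_iff π hm x).1 (h.compat hm)).1 j hj).trans_lt (hx j)
  · intro hN
    obtain ⟨d, hd, rfl⟩ : ∃ d, 0 < d ∧ m = k + d := ⟨m - k, by omega, by omega⟩
    refine ⟨cycWord (letterAt π) k d, fun s => ?_,
      (compat_letterAt π hm).realizes hd (pv_inj π) hpk⟩
    unfold cycWord
    split_ifs
    · have := cyc_lt (k := k) hd s
      exact (letterAt_le_top hb (by omega)).trans_lt hN
    · omega

theorem numSymbols_eq (hb : pv π m ≠ m + 1) : numSymbols π = topLetter π + 1 := by
  have : {N : ℕ | π ∈ allowed (shift N) (m + 1)} = Set.Ici (topLetter π + 1) := by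
    ext N
    exact mem_allowed_iff hb N
  rw [numSymbols, this, csInf_Ici]

theorem splitLength_eq {k : ℕ} (hk : k < m) (hpk : pv π k = pv π m + 1) :
    splitLength π = k := by
  have h1 : splitLength π ≤ k := Nat.sInf_le (show k ∈ {k | _} from hpk)
  have h2 : pv π (splitLength π) = pv π m + 1 :=
    Nat.sInf_mem (s := {k : ℕ | entry π (k + 1) = entry π (m + 1) + 1}) ⟨k, hpk⟩
  exact pv_inj π _ (by omega) _ (by omega) (h2.trans hpk.symm)

theorem wA_eq {k d : ℕ} (hm : m = k + d) (hd : 0 < d) (hpk : pv π k = pv π m + 1) :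
    wA π = cycWord (letterAt π) k d := by
  subst hm
  funext s
  have hl : (firstLetters π).length = k + d := by simp [firstLetters]
  unfold wA
  rw [splitLength_eq (by omega) hpk, add_tsub_cancel_right,
    getD_take_append_wordPow hd _ hl]
  refine congrFun (cycWord_congr hd fun r hr => ?_) s
  rw [List.getD_eq_getElem?_getD, firstLetters, List.getElem?_ofFn, dif_pos (by omega)]
  rfl

theorem realizes_wA (hb : pv π m ≠ m + 1) : Realizes m (wA π) (pv π) := by
  obtain ⟨k, hk, hpk⟩ := exists_split hb
  obtain ⟨d, hd, rfl⟩ : ∃ d, 0 < d ∧ m = k + d := ⟨m - k, by omega, by omega⟩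
  rw [wA_eq rfl hd hpk]
  exact (compat_letterAt π (by omega)).realizes hd (pv_inj π) hpk

theorem mem_diff_iff {N : ℕ} : π ∈ permsNeeding (m + 1) N \ permsFixingLast (m + 1) N ↔
    pv π m ≠ m + 1 ∧ topLetter π + 1 = N := by
  have hpv : entry π (m + 1) = pv π m := rfl
  simp only [permsFixingLast, permsNeeding, Set.mem_sdiff, Set.mem_ofPred_eq, hpv, not_and]
  constructor
  · rintro ⟨h1, h2⟩
    exact ⟨h2 h1, by rw [← numSymbols_eq (h2 h1), h1]⟩
  · rintro ⟨h1, h2⟩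
    exact ⟨by rw [numSymbols_eq h1, h2], fun _ => h1⟩

theorem gNum_eq_ncard (m N : ℕ) :
    gNum (m + 1) N = (permsNeeding (m + 1) N \ permsFixingLast (m + 1) N).ncard := by
  refine Set.InjOn.ncard_image fun π hπ σ hσ h => ?_
  have h1 := realizes_wA (mem_diff_iff.1 hπ).1
  have h2 := realizes_wA (mem_diff_iff.1 hσ).1
  rw [h] at h1
  exact eq_of_realizes h1 h2

theorem gNum_eq_sub (m N : ℕ) :
    (gNum (m + 1) N : ℤ) = (aNum (m + 1) N : ℤ) - (hNum (m + 1) N : ℤ) := by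
  have hsub : permsFixingLast (m + 1) N ⊆ permsNeeding (m + 1) N := fun π h => h.1
  have := Set.ncard_sdiff_add_ncard_of_subset hsub
  rw [gNum_eq_ncard, aNum, hNum, ← this]
  push_cast
  ring

end realize

/-! ### Counting the words compatible with a permutation. -/

open Classical in
-- Sorting identifies monotone functions with multisets of size m.
theorem card_monotone (m r : ℕ) :
    (Finset.univ.filter fun f : Fin m → Fin r => Monotone f).card = r.multichoose m := by
  have h := Sym.card_sym_eq_multichoose (Fin r) m
  rw [Fintype.card_fin] at h
  rw [← h, ← Finset.card_univ]
  refine Finset.card_bij (fun f _ => ⟨(List.ofFn f : Multiset (Fin r)), by simp⟩)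
    (fun _ _ => Finset.mem_univ _) ?_ ?_
  · intro f hf g hg hfg
    rw [Finset.mem_filter] at hf hg
    have hperm : (List.ofFn f).Perm (List.ofFn g) :=
      Multiset.coe_eq_coe.1 (congrArg Subtype.val hfg)
    refine List.ofFn_injective (hperm.eq_of_pairwise' (r := (· ≤ ·)) ?_ ?_)
    · exact List.pairwise_ofFn.2 fun i j hij => hf.2 hij.le
    · exact List.pairwise_ofFn.2 fun i j hij => hg.2 hij.le
  · intro s _
    have hl : (s.1.sort (· ≤ ·)).length = m := by rw [Multiset.length_sort]; exact s.2
    refine ⟨fun i => (s.1.sort (· ≤ ·)).get (i.cast hl.symm), ?_, ?_⟩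
    · rw [Finset.mem_filter]
      refine ⟨Finset.mem_univ _, fun i j hij => ?_⟩
      rcases hij.eq_or_lt with rfl | hij
      · exact le_rfl
      · exact List.pairwise_iff_get.1 (Multiset.pairwise_sort s.1 (· ≤ ·)) _ _ hij
    · refine Subtype.ext ?_
      have : List.ofFn (fun i : Fin m => (s.1.sort (· ≤ ·)).get (i.cast hl.symm)) =
          s.1.sort (· ≤ ·) := by
        refine List.ext_getElem (by rw [List.length_ofFn, hl]) fun i h1 h2 => ?_
        rw [List.getElem_ofFn]
        rfl
      simp only [this, Multiset.sort_eq]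

/-- A finite word, continued by zeros. -/
def extendZero {m N : ℕ} (c : Fin m → Fin N) (i : ℕ) : ℕ := if h : i < m then c ⟨i, h⟩ else 0

theorem extendZero_of_lt {m N : ℕ} (c : Fin m → Fin N) {i : ℕ} (hi : i < m) :
    extendZero c i = c ⟨i, hi⟩ := dif_pos hi

theorem extendZero_lt {m N : ℕ} (c : Fin m → Fin N) {i : ℕ} (hi : i < m) :
    extendZero c i < N := by rw [extendZero_of_lt c hi]; omega

open Classical in
/-- The words over `N` letters that are compatible with `π`. -/
noncomputable def compatWords {m : ℕ} (π : Equiv.Perm (Fin (m + 1))) (N : ℕ) :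
    Finset (Fin m → Fin N) :=
  Finset.univ.filter fun c => Compat m (pv π) (extendZero c)

theorem mem_compatWords {m N : ℕ} {π : Equiv.Perm (Fin (m + 1))} {c : Fin m → Fin N} :
    c ∈ compatWords π N ↔ Compat m (pv π) (extendZero c) := by
  simp [compatWords]

/-- By `compat_iff`, the difference of c and `letterAt π`, read in the order of values, is an
arbitrary weakly increasing sequence in {0, …, r - 1} with r = N - `topLetter π`; the bound needs
checking only at the largest entry. -/
theorem card_compatWords {m N : ℕ} {π : Equiv.Perm (Fin (m + 1))} (hb : pv π m ≠ m + 1) :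
    (compatWords π N).card =
      if topLetter π + 1 ≤ N then (m + (N - (topLetter π + 1))).choose m else 0 := by
  classical
  obtain ⟨j, hj, hpj, htj⟩ := exists_top hb
  have hm : 0 < m := by omega
  split_ifs with hN
  · obtain ⟨r, hr⟩ : ∃ r, N = topLetter π + r := ⟨N - topLetter π, by omega⟩
    have hcount := card_monotone m r
    rw [Nat.multichoose_eq, show r + m - 1 = m + (N - (topLetter π + 1)) by omega] at hcount
    rw [← hcount]
    symm
    set σ := Tuple.sort fun i : Fin m => pv π i
    have hσ : Monotone fun a => pv π (σ a) := Tuple.monotone_sort fun i : Fin m => pv π i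
    have hσ' : ∀ i j : Fin m, pv π i < pv π j → σ.symm i ≤ σ.symm j := by
      intro i j hij
      by_contra hcon
      have := hσ (not_le.1 hcon).le
      simp only [Equiv.apply_symm_apply] at this
      omega
    refine Finset.card_bij (fun f _ => fun i : Fin m =>
      (⟨letterAt π i + f (σ.symm i), by
        have := letterAt_le_top hb i.2.le
        omega⟩ : Fin N)) ?_ ?_ ?_
    · intro f hf
      rw [Finset.mem_filter] at hf
      rw [mem_compatWords, compat_iff π hm]
      constructor
      · intro i hi
        rw [extendZero_of_lt _ hi]
        exact Nat.le_add_right _ _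
      · intro i hi j hj hij
        rw [extendZero_of_lt _ hi, extendZero_of_lt _ hj]
        have : (f (σ.symm ⟨i, hi⟩) : ℕ) ≤ f (σ.symm ⟨j, hj⟩) := hf.2 (hσ' ⟨i, hi⟩ ⟨j, hj⟩ hij)
        simp only
        omega
    · intro f _ g _ hfg
      funext a
      have := congrArg Fin.val (congrFun hfg (σ a))
      simp only [Equiv.symm_apply_apply] at this
      exact Fin.ext (by omega)
    · intro c hc
      rw [mem_compatWords, compat_iff π hm] at hc
      obtain ⟨h1, h2⟩ := hc
      have h1' : ∀ i : Fin m, letterAt π i ≤ c i := fun i => by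
        have := h1 i i.2
        rwa [extendZero_of_lt c i.2] at this
      have h2' : ∀ i j : Fin m, pv π i ≤ pv π j →
          (c i : ℕ) + letterAt π j ≤ c j + letterAt π i := by
        intro i j hij
        rcases hij.eq_or_lt with h | h
        · obtain rfl : i = j := Fin.ext (pv_inj π _ i.2.le _ j.2.le h)
          exact le_rfl
        · have := h2 i i.2 j j.2 h
          rwa [extendZero_of_lt c i.2, extendZero_of_lt c j.2] at this
      refine ⟨fun a => ⟨c (σ a) - letterAt π (σ a), ?_⟩, ?_, ?_⟩
      · have h3 := h2' (σ a) ⟨j, hj⟩ (by rw [hpj]; exact pv_le π (σ a).2.le)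
        have h4 := h1' (σ a)
        simp only [htj] at h3
        have := (c ⟨j, hj⟩).2
        omega
      · rw [Finset.mem_filter]
        refine ⟨Finset.mem_univ _, fun a b hab => ?_⟩
        have h3 := h2' (σ a) (σ b) (hσ hab)
        have h4 := h1' (σ a)
        have h5 := h1' (σ b)
        rw [Fin.mk_le_mk]
        omega
      · funext i
        refine Fin.ext ?_
        have := h1' i
        simp only [Equiv.apply_symm_apply]
        omega
  · rw [Finset.card_eq_zero, Finset.eq_empty_iff_forall_notMem]
    intro c hc
    rw [mem_compatWords, compat_iff π hm] at hc
    have h1 := hc.1 j hj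
    have h2 := extendZero_lt c hj
    omega

/-! ### Double counting by pattern and by split position. -/

open Classical in
/-- The words of length `m` whose part from position `k` on is primitive and not zero. -/
noncomputable def splitWords (m N k : ℕ) : Finset (Fin m → Fin N) :=
  Finset.univ.filter fun c =>
    PrimPart (extendZero c) k (m - k) ∧ ∃ r < m - k, extendZero c (k + r) ≠ 0

theorem mem_splitWords {m N k : ℕ} {c : Fin m → Fin N} : c ∈ splitWords m N k ↔
    PrimPart (extendZero c) k (m - k) ∧ ∃ r < m - k, extendZero c (k + r) ≠ 0 := by
  simp [splitWords]

theorem Compat.congr {m : ℕ} {P c c' : ℕ → ℕ} (hm : 0 < m) (h : ∀ i < m, c i = c' i)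
    (hc : Compat m P c) : Compat m P c' where
  mono i hi j hj hij := by rw [← h i hi, ← h j hj]; exact hc.mono i hi j hj hij
  step i hi j hj hij he := hc.step i hi j hj hij (by rw [h i hi, h j hj, he])
  bottom h1 h2 := by rw [← h (m - 1) (by omega)]; exact hc.bottom h1 h2

theorem exists_perm_of_injective {m : ℕ} {α : Type*} [LinearOrder α] (f : Fin m → α)
    (hf : Function.Injective f) : ∃ π : Equiv.Perm (Fin m), ∀ i j, f i < f j ↔ π i < π j := by
  have h : StrictMono (f ∘ Tuple.sort f) :=
    (Tuple.monotone_sort f).strictMono_of_injective (hf.comp (Tuple.sort f).injective)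
  refine ⟨(Tuple.sort f).symm, fun i j => ?_⟩
  rw [← h.lt_iff_lt]
  simp

theorem cycWord_of_lt {c : ℕ → ℕ} {k d i : ℕ} (hi : i < k + d) : cycWord c k d i = c i := by
  unfold cycWord
  rw [cyc_of_lt hi, if_pos]
  nlinarith [Nat.zero_le k, Nat.zero_le d]

/-- The inverse direction of the double count: π is the pattern of u p^(k+d) 0^∞, and primitivity
makes its tails from k + d and k adjacent. -/
theorem exists_perm_of_primPart {k d : ℕ} {c : ℕ → ℕ} (hd : 0 < d) (hprim : PrimPart c k d)
    (hnz : ∃ r < d, c (k + r) ≠ 0) :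
    ∃ π : Equiv.Perm (Fin (k + d + 1)), pv π k = pv π (k + d) + 1 ∧ Compat (k + d) (pv π) c := by
  obtain ⟨π, hπ⟩ := exists_perm_of_injective
    (fun i : Fin (k + d + 1) => toLex (tailAt (cycWord c k d) i)) (fun i j h =>
      Fin.ext (tailAt_cycWord_injOn hd hnz (by omega) (by omega) (toLex.injective h)))
  have hreal : Realizes (k + d) (cycWord c k d) (pv π) := by
    intro i hi j hj
    rw [pv_eq π hi, pv_eq π hj, Nat.add_lt_add_iff_right]
    exact hπ ⟨i, by omega⟩ ⟨j, by omega⟩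
  refine ⟨π, ?_, (hreal.compat (by omega)).congr (by omega) fun i hi => cycWord_of_lt hi⟩
  have h1 : pv π (k + d) < pv π k := (hreal _ le_rfl _ (by omega)).1 (lexLt_tailAt_last hd hnz)
  by_contra hne
  have h2 := pv_le π (show k ≤ k + d by omega)
  -- Otherwise the position with value `pv π (k + d) + 1` has its tail strictly between the two.
  obtain ⟨i, hi, hpi⟩ := exists_pv_eq π (v := pv π (k + d) + 1) (by omega) (by omega)
  exact not_between_of_primPart hd hprim hi ((hreal _ le_rfl _ hi).2 (by omega))
    ((hreal _ hi _ (by omega)).2 (by omega))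

theorem Compat.of_split {m k : ℕ} {P c : ℕ → ℕ} (hk : k < m)
    (hP : ∀ i ≤ m, ∀ j ≤ m, P i = P j → i = j) (hpk : P k = P m + 1) (hc : Compat m P c) :
    PrimPart c k (m - k) ∧ (∃ r < m - k, c (k + r) ≠ 0) ∧
      Realizes m (cycWord c k (m - k)) P := by
  obtain ⟨d, hd, rfl⟩ : ∃ d, 0 < d ∧ m = k + d := ⟨m - k, by omega, by omega⟩
  rw [Nat.add_sub_cancel_left]
  exact ⟨hc.primPart hd hP hpk, hc.exists_ne_zero hd hP hpk, hc.realizes hd hP hpk⟩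

open Classical in
/-- Double counting of the words `u p ^ (n - 1) 0 ^ ∞` with `p` primitive and nonzero, by the
patterns that they realize and by the length of `u`. -/
theorem sum_card_compatWords (m N : ℕ) :
    ∑ π ∈ Finset.univ.filter (fun π : Equiv.Perm (Fin (m + 1)) => pv π m ≠ m + 1),
      (compatWords π N).card = ∑ k : Fin m, (splitWords m N k).card := by
  rw [← Finset.card_sigma, ← Finset.card_sigma]
  have hsplit : ∀ π : Equiv.Perm (Fin (m + 1)), pv π m ≠ m + 1 →
      splitLength π < m ∧ pv π (splitLength π) = pv π m + 1 := by
    intro π hb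
    obtain ⟨k, hk, hpk⟩ := exists_split hb
    rw [splitLength_eq hk hpk]
    exact ⟨hk, hpk⟩
  have hmem : ∀ x ∈ (Finset.univ.filter
      (fun π : Equiv.Perm (Fin (m + 1)) => pv π m ≠ m + 1)).sigma fun π => compatWords π N,
      pv x.1 m ≠ m + 1 ∧ Compat m (pv x.1) (extendZero x.2) := by
    intro x hx
    rw [Finset.mem_sigma, Finset.mem_filter, mem_compatWords] at hx
    exact ⟨hx.1.2, hx.2⟩
  refine Finset.card_bij (fun x hx => ⟨⟨splitLength x.1, (hsplit x.1 (hmem x hx).1).1⟩, x.2⟩)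
    ?_ ?_ ?_
  · rintro ⟨π, c⟩ hx
    obtain ⟨hb, hc⟩ := hmem _ hx
    obtain ⟨hk, hpk⟩ := hsplit π hb
    simp only [Finset.mem_sigma, Finset.mem_univ, true_and, mem_splitWords]
    have h := hc.of_split hk (pv_inj π) hpk
    exact ⟨h.1, h.2.1⟩
  · rintro ⟨π, c⟩ hx ⟨σ, c'⟩ hy hxy
    obtain ⟨hb, hc⟩ := hmem _ hx
    obtain ⟨hb', hc'⟩ := hmem _ hy
    obtain ⟨hk, hpk⟩ := hsplit π hb
    obtain ⟨hk', hpk'⟩ := hsplit σ hb'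
    simp only [Sigma.mk.injEq, Fin.mk.injEq, heq_eq_eq] at hxy
    obtain ⟨hs, rfl⟩ := hxy
    -- Equal letters and equal split give one word realizing both permutations.
    have h := (hc.of_split hk (pv_inj π) hpk).2.2
    have h' := (hc'.of_split hk' (pv_inj σ) hpk').2.2
    rw [hs] at h
    rw [eq_of_realizes h h']
  · rintro ⟨⟨k, hk⟩, c⟩ hx
    simp only [Finset.mem_sigma, Finset.mem_univ, true_and, mem_splitWords] at hx
    obtain ⟨d, hd, rfl⟩ : ∃ d, 0 < d ∧ m = k + d := ⟨m - k, by omega, by omega⟩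
    rw [Nat.add_sub_cancel_left] at hx
    obtain ⟨π, hpk, hc⟩ := exists_perm_of_primPart hd hx.1 hx.2
    have hb : pv π (k + d) ≠ k + d + 1 := by
      have := pv_le π (show k ≤ k + d by omega)
      omega
    refine ⟨⟨π, c⟩, ?_, ?_⟩
    · rw [Finset.mem_sigma, Finset.mem_filter, mem_compatWords]
      exact ⟨⟨Finset.mem_univ _, hb⟩, hc⟩
    · simp only [splitLength_eq hk hpk]

theorem primPart_iff {k d N : ℕ} (hd : 0 < d) (c : Fin (k + d) → Fin N) :
    PrimPart (extendZero c) k d ↔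
      IsPrimitiveWord (List.ofFn fun r : Fin d => c (Fin.natAdd k r)) := by
  rw [isPrimitiveWord_ofFn_iff hd]
  have h : ∀ x, extendZero c (k + x % d) = c (Fin.natAdd k ⟨x % d, Nat.mod_lt x hd⟩) := fun x =>
    extendZero_of_lt c (Nat.add_lt_add_left (Nat.mod_lt x hd) k)
  refine forall_congr' fun e => forall_congr' fun _ => forall_congr' fun _ => not_congr ?_
  refine forall_congr' fun x => ?_
  simp only [h]
  exact Fin.val_inj

open Classical in
theorem card_splitWords {k d N : ℕ} (hd : 0 < d) :
    (splitWords (k + d) N k).card = N ^ k *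
      (Finset.univ.filter fun p : Fin d → Fin N =>
        IsPrimitiveWord (List.ofFn p) ∧ ∃ r, (p r : ℕ) ≠ 0).card := by
  have hk : N ^ k = (Finset.univ : Finset (Fin k → Fin N)).card := by simp
  rw [hk, ← Finset.card_product]
  symm
  refine Finset.card_equiv (Fin.appendEquiv k d) fun x => ?_
  rw [mem_splitWords, Nat.add_sub_cancel_left, primPart_iff hd]
  simp only [Finset.mem_product, Finset.mem_univ, true_and, Finset.mem_filter,
    Fin.appendEquiv_apply, Fin.append_right]
  refine and_congr_right fun _ => ?_
  have h : ∀ r (hr : r < d), extendZero (Fin.appendEquiv k d x) (k + r) = x.2 ⟨r, hr⟩ := by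
    intro r hr
    rw [extendZero_of_lt _ (show k + r < k + d by omega)]
    exact congrArg Fin.val (Fin.append_right x.1 x.2 ⟨r, hr⟩)
  constructor
  · rintro ⟨r, hr⟩
    exact ⟨r, r.2, by rw [h r r.2]; exact hr⟩
  · rintro ⟨r, hr, h'⟩
    exact ⟨⟨r, hr⟩, by rwa [h r hr] at h'⟩

open Classical in
-- The correction counts the zero word, which is primitive only in length one.
theorem primCount_eq {d N : ℕ} (hd : 0 < d) (hN : 0 < N) :
    primCount N d = (Finset.univ.filter fun p : Fin d → Fin N =>
        IsPrimitiveWord (List.ofFn p) ∧ ∃ r, (p r : ℕ) ≠ 0).card + if d = 1 then 1 else 0 := by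
  have h1 : primCount N d =
      (Finset.univ.filter fun p : Fin d → Fin N => IsPrimitiveWord (List.ofFn p)).card := by
    rw [primCount, ← Set.ncard_coe_finset]
    congr 1
    ext p
    simp
  rw [h1, ← Finset.card_filter_add_card_filter_not (fun p : Fin d → Fin N => ∃ r, (p r : ℕ) ≠ 0),
    Finset.filter_filter, Finset.filter_filter]
  congr 1
  split_ifs with h
  · subst h
    rw [Finset.card_eq_one]
    refine ⟨fun _ => ⟨0, hN⟩, ?_⟩
    ext p
    simp only [Finset.mem_filter, Finset.mem_univ, true_and, Finset.mem_singleton, not_exists,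
      not_not]
    constructor
    · exact fun hp => funext fun r => Fin.ext (hp.2 r)
    · rintro rfl
      refine ⟨?_, fun _ => rfl⟩
      rw [isPrimitiveWord_ofFn_iff hd]
      intro e _ _
      omega
  · rw [Finset.card_eq_zero, Finset.filter_eq_empty_iff]
    rintro p - ⟨hp, hz⟩
    rw [isPrimitiveWord_ofFn_iff hd] at hp
    push Not at hz
    exact hp 1 one_pos (by omega) fun x => Fin.ext (by simp only [hz])

/-- The number of pairs `(u, p)` of words over `N` letters of total length `m` with `p` primitive
and nonzero. -/
theorem sum_card_splitWords {m N : ℕ} (hm : 0 < m) (hN : 0 < N) :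
    ((∑ k : Fin m, (splitWords m N k).card : ℕ) : ℤ) =
      (∑ t ∈ Finset.Icc 1 m, (primCount N t : ℤ) * (N : ℤ) ^ (m - t)) - (N : ℤ) ^ (m - 1) := by
  -- The excluded p = 0 matters only for a one-letter p, that is for k = m - 1.
  have h1 : ∀ k ∈ Finset.range m, ((splitWords m N k).card : ℤ) =
      (primCount N (m - k) : ℤ) * (N : ℤ) ^ k - if k = m - 1 then (N : ℤ) ^ k else 0 := by
    intro k hk
    rw [Finset.mem_range] at hk
    obtain ⟨d, hd, rfl⟩ : ∃ d, 0 < d ∧ m = k + d := ⟨m - k, by omega, by omega⟩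
    rw [card_splitWords hd, Nat.add_sub_cancel_left, primCount_eq hd hN]
    by_cases h : d = 1
    · rw [if_pos h, if_pos (by omega)]
      push_cast
      ring
    · rw [if_neg h, if_neg (by omega)]
      push_cast
      ring
  rw [Fin.sum_univ_eq_sum_range fun k => (splitWords m N k).card]
  push_cast
  rw [Finset.sum_congr rfl h1, Finset.sum_sub_distrib, Finset.sum_ite_eq',
    if_pos (Finset.mem_range.2 (by omega))]
  congr 1
  refine Finset.sum_nbij' (fun k => m - k) (fun t => m - t) ?_ ?_ ?_ ?_ ?_
  · intro k hk
    rw [Finset.mem_range] at hk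
    rw [Finset.mem_Icc]
    omega
  · intro t ht
    rw [Finset.mem_Icc] at ht
    rw [Finset.mem_range]
    omega
  · intro k hk
    rw [Finset.mem_range] at hk
    omega
  · intro t ht
    rw [Finset.mem_Icc] at ht
    omega
  · intro k hk
    rw [Finset.mem_range] at hk
    rw [show m - (m - k) = k by omega]

theorem splitWords_eq_empty {m N k : ℕ} (hN : N ≤ 1) : splitWords m N k = ∅ := by
  rw [Finset.eq_empty_iff_forall_notMem]
  intro c hc
  obtain ⟨-, r, hr, h⟩ := mem_splitWords.1 hc
  have := extendZero_lt c (show k + r < m by omega)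
  omega

/-! ### Inversion by generating functions and conclusion. -/

open PowerSeries in
theorem coeff_one_sub_X_pow (n i : ℕ) :
    coeff i ((1 - X : ℤ⟦X⟧) ^ n) = (-1) ^ i * (n.choose i : ℤ) := by
  have h : (1 - X : ℤ⟦X⟧) ^ n =
      (((1 + Polynomial.X) ^ n : Polynomial ℤ) : ℤ⟦X⟧).evalNegHom := by
    simp [evalNegHom, sub_eq_add_neg]
  rw [h, evalNegHom, coeff_rescale, Polynomial.coeff_coe, Polynomial.coeff_one_add_X_pow]

open PowerSeries in
/-- Inversion of a sum over shifted binomial coefficients. -/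
theorem card_filter_eq_alternating_sum {ι : Type*} (s : Finset ι) (f : ι → ℕ) (m N : ℕ)
    (F : ℕ → ℤ) (hF : ∀ N, F N = ∑ x ∈ s, if f x ≤ N then ((m + (N - f x)).choose m : ℤ) else 0) :
    ((s.filter fun x => f x = N).card : ℤ) =
      ∑ i ∈ Finset.range (N + 1), (-1) ^ i * ((m + 1).choose i : ℤ) * F (N - i) := by
  -- The binomial series is (1 - X)^(-(m+1)), and the factor X^(f x) shifts it to start at f x.
  have h1 : (∑ x ∈ s, (X : ℤ⟦X⟧) ^ f x) * (mk fun n => ((m + n).choose m : ℤ)) = mk F := by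
    ext M
    rw [Finset.sum_mul, map_sum, coeff_mk, hF]
    refine Finset.sum_congr rfl fun x _ => ?_
    rw [coeff_X_pow_mul', coeff_mk]
  have h2 : ∑ x ∈ s, (X : ℤ⟦X⟧) ^ f x = (1 - X) ^ (m + 1) * mk F := by
    rw [← h1, mul_left_comm, mul_comm ((1 - X) ^ (m + 1)),
      mk_add_choose_mul_one_sub_pow_eq_one ℤ m, mul_one]
  have h3 := congrArg (coeff N) h2
  rw [map_sum, coeff_mul, Finset.Nat.sum_antidiagonal_eq_sum_range_succ_mk] at h3
  simp only [coeff_X_pow, coeff_mk, coeff_one_sub_X_pow] at h3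
  rw [← h3, Finset.card_filter]
  push_cast
  exact Finset.sum_congr rfl fun x _ => if_congr eq_comm rfl rfl

open Classical in
theorem gNum_eq_alternating_sum {m N : ℕ} (hm : 0 < m) (hN : 2 ≤ N) :
    (gNum (m + 1) N : ℤ) = ∑ i ∈ Finset.range (N - 1), (-1 : ℤ) ^ i * ((m + 1).choose i : ℤ) *
      ((∑ t ∈ Finset.Icc 1 m, (primCount (N - i) t : ℤ) * ((N - i : ℕ) : ℤ) ^ (m - t)) -
        ((N - i : ℕ) : ℤ) ^ (m - 1)) := by
  set s := Finset.univ.filter fun π : Equiv.Perm (Fin (m + 1)) => pv π m ≠ m + 1 with hs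
  have hg : gNum (m + 1) N = (s.filter fun π => topLetter π + 1 = N).card := by
    rw [gNum_eq_ncard, ← Set.ncard_coe_finset]
    congr 1
    ext π
    rw [mem_diff_iff]
    simp [hs]
  have hF : ∀ M, ((∑ k : Fin m, (splitWords m M k).card : ℕ) : ℤ) =
      ∑ π ∈ s, if topLetter π + 1 ≤ M then ((m + (M - (topLetter π + 1))).choose m : ℤ) else 0 := by
    intro M
    rw [← sum_card_compatWords]
    push_cast
    refine Finset.sum_congr rfl fun π hπ => ?_
    rw [card_compatWords (Finset.mem_filter.1 hπ).2]
    push_cast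
    rfl
  obtain ⟨M, rfl⟩ : ∃ M, N = M + 1 := ⟨N - 1, by omega⟩
  rw [hg, card_filter_eq_alternating_sum s _ m _ _ hF, Finset.sum_range_succ,
    Finset.sum_range_succ, Nat.add_sub_cancel]
  -- The terms i = M and i = M + 1 concern alphabets of at most one letter, over which no nonzero p
  -- exists; hence the sum stops at N - 2.
  have h0 : ∀ i, M + 1 - i ≤ 1 → (∑ k : Fin m, (splitWords m (M + 1 - i) k).card : ℕ) = 0 :=
    fun i hi => Finset.sum_eq_zero fun k _ => by rw [splitWords_eq_empty hi, Finset.card_empty]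
  rw [h0 M (by omega), h0 (M + 1) (by omega)]
  simp only [Nat.cast_zero, mul_zero, add_zero]
  refine Finset.sum_congr rfl fun i hi => ?_
  rw [Finset.mem_range] at hi
  rw [sum_card_splitWords hm (by omega)]

end ShiftPatterns

theorem mainTheorem8 (n N : ℕ) (hn : 2 ≤ n) (hN : 2 ≤ N) :
    (ShiftPatterns.gNum n N : ℤ) =
        (ShiftPatterns.aNum n N : ℤ) - (ShiftPatterns.hNum n N : ℤ) ∧
      (ShiftPatterns.gNum n N : ℤ) =
        ∑ i ∈ Finset.range (N - 1), (-1 : ℤ) ^ i * (n.choose i : ℤ) *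
          ((∑ t ∈ Finset.Icc 1 (n - 1),
              (ShiftPatterns.primCount (N - i) t : ℤ) * ((N - i : ℕ) : ℤ) ^ (n - t - 1))
            - ((N - i : ℕ) : ℤ) ^ (n - 2)) := by
  obtain ⟨m, hm, rfl⟩ : ∃ m, 0 < m ∧ n = m + 1 := ⟨n - 1, by omega, by omega⟩
  refine ⟨ShiftPatterns.gNum_eq_sub m N, ?_⟩
  rw [ShiftPatterns.gNum_eq_alternating_sum hm hN]
  refine Finset.sum_congr rfl fun i _ => ?_
  rw [Nat.add_sub_cancel, show m + 1 - 2 = m - 1 by omega]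
  congr 2
  refine Finset.sum_congr rfl fun t _ => ?_
  rw [show m + 1 - t - 1 = m - t by omega]
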